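/- Setting. Let $0<\bar q\le\infty$ and let $P:(0,\bar q)\to\mathbb R$ be a strictly decreasing inverse demand function for which $U(q)=\int_0^q P(x)\,dx$ is finite (converges absolutely) for every $q\in(0,\bar q)$. Its consumer surplus is $CS(q)=\int_0^q P(x)\,dx-qP(q)$. The demand satisfies the complete monotonicity criterion if $CS$ is a completely monotone function of $-s=-\log q$, i.e. $s\mapsto CS(e^s)$ has derivatives of all orders on $s<\log\bar q$ and $\frac{d^n}{ds^n}CS(e^s)\ge 0$ for all $n\ge 0$. Bulow–Pfleiderer (BP) demand means $P(q)=p_0+p_tq^{-t}$ with real constants $p_0,p_t,t$, or its limiting case $t\to0$, exponential demand $P(q)=a-b\log q$. For a monopolist with constant marginal cost $c$, who chooses a quantity in the domain of $P$ to maximize $(P(q)-c)q$, the pass-through rate at quantity $q$ is the derivative with respect to $c$ of the monopoly price, at the cost $c$ for which the (locally in $c$ existing and unique) optimal quantity is $q$. Theorem. If the demand satisfies the complete monotonicity criterion, then the constant-marginal-cost monopoly pass-through rate is well defined at every $q\in(0,\bar q)$. It is strictly decreasing in $q$, with the only exception of BP demand, for which it is constant. Corollary. For the inverse demand functions $P$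 below, the inverses of the survival functions of the named distributions of consumer values (all scale parameters positive, location parameters arbitrary, $q\in(0,1)$ unless stated otherwise), the constant-marginal-cost monopoly pass-through rate is well defined and strictly decreasing in quantity: - logistic, $P=\mu-\beta\log\left(\frac1{1-q}-1\right)$; - log-logistic, $P=\sigma\left(\frac q{1-q}\right)^{-1/\gamma}$, $\gamma>1$; - Gumbel, $P=\alpha+\beta\log(-\log q)$; - Weibull, $P=\beta(-\log q)^{1/\alpha}$, $\alpha>1$; - Fréchet, $P=\mu+\beta(-\log(1-q))^{-1/\alpha}$, $\alpha>1$; - gamma with shape $\alpha>1$ and scale $\beta$; - Singh–Maddala, $P=b(q^{-1/k}-1)^{1/a}$, $k>0$, $a>1$, $ak\ge1$; - Tukey lambda, $P=\frac{(1-q)^\lambda-q^\lambda}\lambda$ ($P=\log\frac{1-q}q$ for $\lambda=0$), $-1\le\lambda<1$; - Wakeby, $P=\mu-\frac{\gamma(1-q^{-\delta})}\delta+\frac{\alpha(1-q^\beta)}\beta$, $\alpha,\gamma>0$, $\beta>1$, $0<\delta\le1$; - Pareto type IV, $P=\mu+k(q^{-1/\alpha}-1)^\gamma$, $0<\gamma<1$,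 $\alpha\ge\gamma$; - Cauchy, $P=a+b\tan\left(\pi\left(\tfrac12-q\right)\right)$. For the Laplace distribution, $P=\mu-\beta\log(2q)$ for $q\le\frac12$ and $P=\mu+\beta\log(2(1-q))$ for $q>\frac12$, the rate is well defined and weakly decreasing on $(0,1)\setminus\{\frac12\}$, equal to $1$ for $q<\frac12$ (where demand is exponential) and strictly decreasing for $q>\frac12$. For constant-elasticity (Pareto) demand $P=\beta q^{-1/\varepsilon}$ and BP demand $P=\mu+\beta q^{-1/\varepsilon}$ with $\beta>0$, $\varepsilon>1$ on any $(0,\bar q)$, and for the generalized Pareto (Pickands) distribution $P=\mu+\frac{\sigma(q^{-\gamma}-1)}\gamma$ ($P=\mu-\sigma\log q$ for $\gamma=0$), $\gamma<1$, which is BP demand, the rate is well defined and constant. -/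

import Mathlib

open Set Filter Topology MeasureTheory
open scoped ContDiff

noncomputable section

namespace PassThrough

/-! ### Demand, consumer surplus and the complete monotonicity criterion -/

/-- The quantities `0 < q < qbar` at which an inverse demand function is considered; `qbar` may be
`⊤`, which gives all positive quantities. -/
def quantityRange (qbar : EReal) : Set ℝ := {q : ℝ | 0 < q ∧ (q : EReal) < qbar}

/-- `P` is an inverse demand function on `0 < q < qbar`: it is strictly decreasing, and the utility
`U q = ∫ x in 0..q, P x` (with `U 0 = 0`) is finite, so that consumer surplus is defined. -/
structure IsInverseDemand (P : ℝ → ℝ) (qbar : EReal) : Prop where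
  strictAnti : StrictAntiOn P (quantityRange qbar)
  integrable : ∀ q ∈ quantityRange qbar, IntegrableOn P (Ioc 0 q)

/-- Consumer surplus `CS q = ∫₀^q P - q P q`. -/
def consumerSurplus (P : ℝ → ℝ) (q : ℝ) : ℝ := (∫ x in (0 : ℝ)..q, P x) - q * P q

/-- A function is completely monotone on the (open) set `S` when it has derivatives of all orders
there and `(-1) ^ n * f⁽ⁿ⁾ ≥ 0` for all `n`. -/
def CompletelyMonotoneOn (f : ℝ → ℝ) (S : Set ℝ) : Prop :=
  ContDiffOn ℝ ∞ f S ∧ ∀ n : ℕ, ∀ x ∈ S, 0 ≤ (-1 : ℝ) ^ n * iteratedDeriv n f x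

/-- The complete monotonicity criterion: consumer surplus is a completely monotone function of
minus log quantity, `x = -log q`. -/
def CompleteMonotonicityCriterion (P : ℝ → ℝ) (qbar : EReal) : Prop :=
  CompletelyMonotoneOn (fun x => consumerSurplus P (Real.exp (-x)))
    {x : ℝ | Real.exp (-x) ∈ quantityRange qbar}

/-- Bulow–Pfleiderer inverse demand `p₀ + pₜ q ^ (-t)` on `D`, including its limiting case as
`t → 0`, exponential demand `a - b log q`. -/
def IsBulowPfleiderer (P : ℝ → ℝ) (D : Set ℝ) : Prop :=
  (∃ p₀ pₜ t : ℝ, ∀ q ∈ D, P q = p₀ + pₜ * q ^ (-t)) ∨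
    (∃ a b : ℝ, ∀ q ∈ D, P q = a - b * Real.log q)

/-! ### The pass-through rate of a monopolist with constant marginal cost -/

/-- `q` maximizes the profit `(P x - c) * x` over `x ∈ D`, for constant marginal cost `c`. -/
def IsMonopolyQuantity (P : ℝ → ℝ) (D : Set ℝ) (c q : ℝ) : Prop :=
  q ∈ D ∧ ∀ x ∈ D, (P x - c) * x ≤ (P q - c) * q

/-- `r` is the pass-through rate at the quantity `q`: for some constant marginal cost `c` the
monopolist chooses `q`, for all marginal costs near `c` the optimal quantity `Q` exists and is
unique, and `r` is the derivative of the monopoly price `P ∘ Q` with respect to marginal cost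
at `c`. -/
def HasPassThroughRate (P : ℝ → ℝ) (D : Set ℝ) (q r : ℝ) : Prop :=
  ∃ (c : ℝ) (Q : ℝ → ℝ), Q c = q ∧
    (∀ᶠ c' in 𝓝 c, ∀ x, IsMonopolyQuantity P D c' x ↔ x = Q c') ∧
    HasDerivAt (fun c' => P (Q c')) r c

/-- At every quantity `q ∈ E` the pass-through rate (of the monopolist who chooses quantities
in `D`) exists, is unique, and equals `ρ q`. -/
def IsPassThroughRateOn (P : ℝ → ℝ) (D E : Set ℝ) (ρ : ℝ → ℝ) : Prop :=
  ∀ q ∈ E, ∀ r, HasPassThroughRate P D q r ↔ r = ρ q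

/-- The pass-through rate exists at all quantities in `D` and is strictly decreasing in quantity. -/
def DecreasingPassThrough (P : ℝ → ℝ) (D : Set ℝ) : Prop :=
  ∃ ρ : ℝ → ℝ, IsPassThroughRateOn P D D ρ ∧ StrictAntiOn ρ D

/-- The pass-through rate exists at all quantities in `D` and is the same at all of them. -/
def ConstantPassThrough (P : ℝ → ℝ) (D : Set ℝ) : Prop :=
  ∃ r : ℝ, IsPassThroughRateOn P D D (fun _ => r)

/-! ### Inverse demand functions generated by common distributions of consumer values

Each is the inverse of the survival function `P ↦ q` of the distribution. -/

/-- Inverse of `q = (P / β) ^ (-ε)`. -/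
def constantElasticity (β ε q : ℝ) : ℝ := β * q ^ (-(1 / ε))

/-- Inverse of `q = ((P - μ) / β) ^ (-ε)`. -/
def constantPassThroughDemand (μ β ε q : ℝ) : ℝ := μ + β * q ^ (-(1 / ε))

/-- Inverse of `q = (exp ((P - μ) / β) + 1)⁻¹`. -/
def logistic (μ β q : ℝ) : ℝ := μ - β * Real.log (1 / (1 - q) - 1)

/-- Inverse of `q = ((P / σ) ^ γ + 1)⁻¹`. -/
def logLogistic (γ σ q : ℝ) : ℝ := σ * (q / (1 - q)) ^ (-(1 / γ))

/-- Inverse of `q = exp (-exp ((P - α) / β))`. -/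
def gumbel (α β q : ℝ) : ℝ := α + β * Real.log (-Real.log q)

/-- Inverse of `q = exp (-(P / β) ^ α)`. -/
def weibull (α β q : ℝ) : ℝ := β * (-Real.log q) ^ (1 / α)

/-- Inverse of `q = 1 - exp (-((P - μ) / β) ^ (-α))`. -/
def frechet (α β μ q : ℝ) : ℝ := μ + β * (-Real.log (1 - q)) ^ (-(1 / α))

/-- `P` is the inverse demand generated by the gamma distribution with shape `α` and scale `β`
(rate `1 / β`): the inverse of its survival function on the positive reals. -/
def IsGammaInverseDemand (α β : ℝ) (P : ℝ → ℝ) : Prop :=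
  ∀ q ∈ Ioo (0 : ℝ) 1, 0 < P q ∧
    1 - ProbabilityTheory.cdf (ProbabilityTheory.gammaMeasure α (1 / β)) (P q) = q

/-- Laplace distribution: inverse of `q = exp ((μ - P) / β) / 2` for `q ≤ 1 / 2` and of
`q = 1 - exp ((P - μ) / β) / 2` for `q > 1 / 2`. -/
def laplace (μ β q : ℝ) : ℝ :=
  if q ≤ 1 / 2 then μ - β * Real.log (2 * q) else μ + β * Real.log (2 * (1 - q))

/-- Inverse of `q = ((P / b) ^ a + 1) ^ (-k)`. -/
def singhMaddala (k a b q : ℝ) : ℝ := b * (q ^ (-(1 / k)) - 1) ^ (1 / a)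

/-- `((1 - q) ^ lam - q ^ lam) / lam`, with its limit `log ((1 - q) / q)` at `lam = 0`. -/
def tukeyLambda (lam q : ℝ) : ℝ :=
  if lam = 0 then Real.log ((1 - q) / q) else ((1 - q) ^ lam - q ^ lam) / lam

/-- Wakeby inverse demand, which is defined by its quantile function. -/
def wakeby (α β γ δ μ q : ℝ) : ℝ := μ - γ * (1 - q ^ (-δ)) / δ + α * (1 - q ^ β) / β

/-- Pareto distribution of type IV: inverse of `q = (1 + ((P - μ) / k) ^ (1 / γ)) ^ (-α)`. -/
def paretoIV (k α γ μ q : ℝ) : ℝ := μ + k * (q ^ (-(1 / α)) - 1) ^ γ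

/-- Generalized Pareto (Pickands) distribution: inverse of
`q = (1 + γ * (P - μ) / σ) ^ (-(1 / γ))`, and of `q = exp (-(P - μ) / σ)` at `γ = 0`. -/
def generalizedPareto (μ σ γ q : ℝ) : ℝ :=
  if γ = 0 then μ - σ * Real.log q else μ + σ * (q ^ (-γ) - 1) / γ

/-- Cauchy distribution: inverse of `q = arctan ((a - P) / b) / π + 1 / 2`. -/
def cauchy (a b q : ℝ) : ℝ := a + b * Real.tan (Real.pi * (1 / 2 - q))

end PassThrough

end

open PassThrough

open PassThrough

namespace PassThrough

/-! Everything reduces to the elasticity of the slope of demand, `w = q P'' / P'`. Marginal revenue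
`M = P' q + P` has derivative `P' (2 + w)`. If `P' < 0` and `w > -2`, then `M` is strictly
decreasing, the first-order condition `M q = c` characterizes the unique optimum, and the
pass-through rate is `P' / M' = 1 / (2 + w)`. So pass-through falls in quantity when `w` rises, and
is constant when `w` is.

For the theorem, put `x = -log q` and let `H n` be `(-1) ^ n` times the `n`-th derivative of
consumer surplus in `x`. Since `CS' = -q P'`, one gets `P' = -H 1 / q ^ 2` and `w = H 2 / H 1 - 2`;
the pass-through rate is `H 1 / H 2`. The function `H 1` is itself completely monotone on a
half-line unbounded above, hence logarithmically convex (`log_convex`), which says that `H 2 / H 1`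
is nonincreasing in `x`. If the ratio takes the same value at two points, it is constant between
them, and `H 1` is an exponential there. Completely monotone functions are real analytic, so `H 1`
is that exponential everywhere (`eqOn_of_eventuallyEq`), and integrating `P' = -C q ^ (l - 2)` gives
BP demand. Both facts are proved by elementary calculus instead of through Bernstein's integral
representation.

The corollary does not go through the criterion. For each distribution except Laplace, `w` is
computed in closed form (for gamma, through its Mills ratio), and the bound `-2 < w` and its
monotonicity or constancy are checked. Laplace demand has a kink in marginal revenue at `1 / 2`, so
there the formula `P' / M'` is applied on each side separately. -/

theorem hasDerivAt_of_strictAntiOn_inverse {M Q : ℝ → ℝ} {D : Set ℝ} (hD : IsOpen D)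
    (hM : StrictAntiOn M D) {c q m : ℝ} (hq : Q c = q)
    (hQ : ∀ᶠ c' in 𝓝 c, Q c' ∈ D ∧ M (Q c') = c') (hm : HasDerivAt M m q) (hm0 : m ≠ 0) :
    HasDerivAt Q m⁻¹ c := by
  obtain ⟨hqD, hqc⟩ := hQ.self_of_nhds
  rw [hq] at hqD hqc
  -- Continuity of `Q` is not assumed: a local right inverse of a strictly decreasing function is
  -- squeezed between points `b` of `D` on either side of `q`. Differentiability of `M` at the
  -- single point `q` then suffices.
  have hcont : ContinuousAt Q c := by
    rw [ContinuousAt, hq, tendsto_order]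
    obtain ⟨l, u, ⟨hl, hu⟩, hlu⟩ := mem_nhds_iff_exists_Ioo_subset.mp (hD.mem_nhds hqD)
    constructor
    · intro a ha
      obtain ⟨b, hb1, hb2⟩ := exists_between (max_lt ha hl)
      have hbD : b ∈ D := hlu ⟨(le_max_right _ _).trans_lt hb1, hb2.trans hu⟩
      have h1 : c < M b := hqc ▸ hM hbD hqD hb2
      filter_upwards [hQ, Iio_mem_nhds h1] with c' h2 h3
      refine ((le_max_left a l).trans_lt hb1).trans ?_
      by_contra! h4
      have := hM.antitoneOn h2.1 hbD h4
      rw [h2.2] at this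
      exact absurd h3 (not_lt.mpr this)
    · intro a ha
      obtain ⟨b, hb1, hb2⟩ := exists_between (lt_min ha hu)
      have hbD : b ∈ D := hlu ⟨hl.trans hb1, hb2.trans_le (min_le_right _ _)⟩
      have h1 : M b < c := hqc ▸ hM hqD hbD hb1
      filter_upwards [hQ, Ioi_mem_nhds h1] with c' h2 h3
      refine lt_trans ?_ (hb2.trans_le (min_le_left a u))
      by_contra! h4
      have := hM.antitoneOn hbD h2.1 h4
      rw [h2.2] at this
      exact absurd h3 (not_lt.mpr this)
  exact HasDerivAt.of_local_left_inverse hcont (hq.symm ▸ hm) hm0 (hQ.mono fun _ h => h.2)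

/-! ### Marginal revenue and the pass-through formula -/

section MarginalRevenue

variable {P M : ℝ → ℝ} {D : Set ℝ}

/-- Profit has derivative `M - c`. Openness of `D` makes every maximizer a critical point;
conversely, as `M` is strictly decreasing, profit rises before the critical point and falls after
it, so that point is the global maximum. -/
theorem isMonopolyQuantity_iff (hD : IsOpen D) (hDc : D.OrdConnected)
    (hM : ∀ q ∈ D, HasDerivAt (fun x => P x * x) (M q) q) (hMa : StrictAntiOn M D) (c x : ℝ) :
    IsMonopolyQuantity P D c x ↔ x ∈ D ∧ M x = c := by
  have hπ : ∀ q ∈ D, HasDerivAt (fun x => (P x - c) * x) (M q - c) q := fun q hq => by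
    refine ((hM q hq).sub ((hasDerivAt_id q).const_mul c)).congr_deriv (by rw [mul_one])
      |>.congr_of_eventuallyEq (.of_forall fun y => ?_)
    simp only [Pi.sub_apply, id]
    ring
  constructor
  · rintro ⟨hx, hmax⟩
    refine ⟨hx, ?_⟩
    have hloc : IsLocalMax (fun x => (P x - c) * x) x :=
      Filter.eventually_of_mem (hD.mem_nhds hx) hmax
    linarith [hloc.hasDerivAt_eq_zero (hπ x hx)]
  · rintro ⟨hx, rfl⟩
    refine ⟨hx, fun y hy => ?_⟩
    rcases lt_trichotomy y x with h | rfl | h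
    · have hsub := hDc.out hy hx
      obtain ⟨ξ, hξ, he⟩ := exists_hasDerivAt_eq_slope (fun z => (P z - M x) * z) _ h
        (fun z hz => (hπ z (hsub hz)).continuousAt.continuousWithinAt)
        (fun z hz => hπ z (hsub (Ioo_subset_Icc_self hz)))
      have h1 := hMa (hsub (Ioo_subset_Icc_self hξ)) hx hξ.2
      rw [eq_div_iff (by linarith)] at he
      nlinarith
    · exact le_rfl
    · have hsub := hDc.out hx hy
      obtain ⟨ξ, hξ, he⟩ := exists_hasDerivAt_eq_slope (fun z => (P z - M x) * z) _ h
        (fun z hz => (hπ z (hsub hz)).continuousAt.continuousWithinAt)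
        (fun z hz => hπ z (hsub (Ioo_subset_Icc_self hz)))
      have h1 := hMa hx (hsub (Ioo_subset_Icc_self hξ)) hξ.1
      rw [eq_div_iff (by linarith)] at he
      nlinarith

theorem image_mem_nhds_of_strictAntiOn (hD : IsOpen D) (hDc : D.OrdConnected)
    (hMa : StrictAntiOn M D) (hMc : ContinuousOn M D) {q : ℝ} (hq : q ∈ D) :
    M '' D ∈ 𝓝 (M q) := by
  obtain ⟨l, u, ⟨hl, hu⟩, hlu⟩ := mem_nhds_iff_exists_Ioo_subset.mp (hD.mem_nhds hq)
  obtain ⟨a, ha1, ha2⟩ := exists_between hl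
  obtain ⟨b, hb1, hb2⟩ := exists_between hu
  have haD : a ∈ D := hlu ⟨ha1, ha2.trans hu⟩
  have hbD : b ∈ D := hlu ⟨hl.trans hb1, hb2⟩
  have hsub := hDc.out haD hbD
  refine mem_of_superset (Icc_mem_nhds (hMa hq hbD hb1) (hMa haD hq ha2)) ?_
  exact (intermediate_value_Icc' (ha2.trans hb1).le (hMc.mono hsub)).trans (image_mono hsub)

/-- The optimal quantity inverts `M` near `c = M q`, so its derivative in cost is `1 / m`, and the
chain rule gives `p / m`. Only differentiability at `q` is needed; this is what handles Laplace
demand, whose marginal revenue is not differentiable everywhere. -/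
theorem hasPassThroughRate_iff (hD : IsOpen D) (hDc : D.OrdConnected)
    (hM : ∀ q ∈ D, HasDerivAt (fun x => P x * x) (M q) q) (hMa : StrictAntiOn M D)
    (hMc : ContinuousOn M D) {q p m r : ℝ} (hq : q ∈ D) (hp : HasDerivAt P p q)
    (hm : HasDerivAt M m q) (hm0 : m ≠ 0) :
    HasPassThroughRate P D q r ↔ r = p / m := by
  have key := isMonopolyQuantity_iff hD hDc hM hMa
  constructor
  · rintro ⟨c, Q, hQc, hev, hr⟩
    have hQ : HasDerivAt Q m⁻¹ c := by
      refine hasDerivAt_of_strictAntiOn_inverse hD hMa hQc ?_ hm hm0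
      filter_upwards [hev] with c' hc'
      exact (key c' _).mp ((hc' _).mpr rfl)
    subst hQc
    exact hr.unique (hp.comp c hQ)
  · rintro rfl
    have hinv : ∀ c' ∈ M '' D, Function.invFunOn M D c' ∈ D ∧ M (Function.invFunOn M D c') = c' :=
      fun c' hc' => ⟨Function.invFunOn_mem hc', Function.invFunOn_eq hc'⟩
    have hev := image_mem_nhds_of_strictAntiOn hD hDc hMa hMc hq
    have hQc : Function.invFunOn M D (M q) = q :=
      hMa.injOn (hinv _ ⟨q, hq, rfl⟩).1 hq (hinv _ ⟨q, hq, rfl⟩).2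
    refine ⟨M q, Function.invFunOn M D, hQc, ?_, ?_⟩
    · filter_upwards [hev] with c' hc' x
      rw [key]
      constructor
      · rintro ⟨hx, hxc⟩
        exact hMa.injOn hx (hinv c' hc').1 (hxc.trans (hinv c' hc').2.symm)
      · rintro rfl
        exact hinv c' hc'
    · have hQ : HasDerivAt (Function.invFunOn M D) m⁻¹ (M q) :=
        hasDerivAt_of_strictAntiOn_inverse hD hMa hQc (mem_of_superset hev hinv) hm hm0
      rw [← hQc] at hp
      exact hp.comp (M q) hQ

end MarginalRevenue

/-! ### Pass-through from the elasticity of the slope of demand -/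

section Curvature

variable {P p w : ℝ → ℝ} {D : Set ℝ}

/-- Writing `P''` as `p * w / q` makes `w` the elasticity of `P'`; then `M' = p (2 + w)`, and `p`
cancels in `P' / M'`. -/
theorem isPassThroughRateOn_of_curvature (hD : IsOpen D) (hDc : D.OrdConnected)
    (hpos : ∀ q ∈ D, 0 < q) (hP : ∀ q ∈ D, HasDerivAt P (p q) q) (hneg : ∀ q ∈ D, p q < 0)
    (hp : ∀ q ∈ D, HasDerivAt p (p q * w q / q) q) (hw : ∀ q ∈ D, -2 < w q) :
    IsPassThroughRateOn P D D (fun q => 1 / (2 + w q)) := by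
  have hM : ∀ q ∈ D, HasDerivAt (fun x => P x * x) (p q * q + P q) q := fun q hq => by
    have := (hP q hq).mul (hasDerivAt_id q)
    rwa [mul_one] at this
  have hM' : ∀ q ∈ D, HasDerivAt (fun q => p q * q + P q) (p q * (2 + w q)) q := fun q hq => by
    refine (((hp q hq).mul (hasDerivAt_id q)).add (hP q hq)).congr_deriv ?_
    have := (hpos q hq).ne'
    rw [id]
    field_simp
    ring
  have hlt : ∀ q ∈ D, p q * (2 + w q) < 0 := fun q hq =>
    mul_neg_of_neg_of_pos (hneg q hq) (by linarith [hw q hq])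
  have hMc : ContinuousOn (fun q => p q * q + P q) D := fun q hq =>
    (hM' q hq).continuousAt.continuousWithinAt
  have hMa : StrictAntiOn (fun q => p q * q + P q) D := by
    refine strictAntiOn_of_deriv_neg hDc.convex hMc fun q hq => ?_
    rw [hD.interior_eq] at hq
    rw [(hM' q hq).deriv]
    exact hlt q hq
  intro q hq r
  rw [hasPassThroughRate_iff hD hDc hM hMa hMc hq (hP q hq) (hM' q hq) (hlt q hq).ne]
  rw [div_mul_eq_div_div, div_self (hneg q hq).ne]

theorem decreasingPassThrough_of_curvature (hD : IsOpen D) (hDc : D.OrdConnected)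
    (hpos : ∀ q ∈ D, 0 < q) (hP : ∀ q ∈ D, HasDerivAt P (p q) q) (hneg : ∀ q ∈ D, p q < 0)
    (hp : ∀ q ∈ D, HasDerivAt p (p q * w q / q) q) (hw : ∀ q ∈ D, -2 < w q)
    (hmono : StrictMonoOn w D) : DecreasingPassThrough P D :=
  ⟨_, isPassThroughRateOn_of_curvature hD hDc hpos hP hneg hp hw, fun a ha b hb hab =>
    one_div_lt_one_div_of_lt (by linarith [hw a ha]) (by linarith [hmono ha hb hab])⟩

theorem constantPassThrough_of_curvature {w₀ : ℝ} (hD : IsOpen D) (hDc : D.OrdConnected)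
    (hpos : ∀ q ∈ D, 0 < q) (hP : ∀ q ∈ D, HasDerivAt P (p q) q) (hneg : ∀ q ∈ D, p q < 0)
    (hp : ∀ q ∈ D, HasDerivAt p (p q * w₀ / q) q) (hw : -2 < w₀) : ConstantPassThrough P D :=
  ⟨_, isPassThroughRateOn_of_curvature hD hDc hpos hP hneg hp (fun _ _ => hw)⟩

end Curvature

/-! ### Quantity ranges and completely monotone functions as sequences of signed derivatives -/

theorem isOpen_quantityRange (qbar : EReal) : IsOpen (quantityRange qbar) :=
  (isOpen_lt continuous_const continuous_id).inter
    (isOpen_lt continuous_coe_real_ereal continuous_const)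

theorem quantityRange_mem_of_le {qbar : EReal} {x y : ℝ} (hy : y ∈ quantityRange qbar)
    (hx : 0 < x) (hxy : x ≤ y) : x ∈ quantityRange qbar :=
  ⟨hx, (EReal.coe_le_coe_iff.mpr hxy).trans_lt hy.2⟩

theorem ordConnected_quantityRange (qbar : EReal) : (quantityRange qbar).OrdConnected :=
  ⟨fun _ hx _ hy _ hz => quantityRange_mem_of_le hy (hx.1.trans_le hz.1) hz.2⟩

/-- `H n` is `(-1) ^ n` times the `n`-th derivative of the completely monotone function `H 0`
on `S`. -/
def IsMonotoneSequence (H : ℕ → ℝ → ℝ) (S : Set ℝ) : Prop :=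
  ∀ n, ∀ x ∈ S, HasDerivAt (H n) (-H (n + 1) x) x ∧ 0 ≤ H n x

theorem CompletelyMonotoneOn.isMonotoneSequence {f : ℝ → ℝ} {S : Set ℝ} (hS : IsOpen S)
    (hf : CompletelyMonotoneOn f S) :
    IsMonotoneSequence (fun n x => (-1) ^ n * iteratedDeriv n f x) S := by
  refine fun n x hx => ⟨?_, hf.2 n x hx⟩
  have hd : DifferentiableAt ℝ (iteratedDeriv n f) x := by
    have h1 := (hf.1.differentiableOn_iteratedDerivWithin (m := n)
      (by exact_mod_cast WithTop.coe_lt_top n) hS.uniqueDiffOn) x hx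
    refine (h1.differentiableAt (hS.mem_nhds hx)).congr_of_eventuallyEq ?_
    filter_upwards [hS.mem_nhds hx] with y hy
    exact (iteratedDerivWithin_of_isOpen hS hy).symm
  refine (hd.hasDerivAt.const_mul ((-1) ^ n)).congr_deriv ?_
  simp only [iteratedDeriv_succ, pow_succ]
  ring

namespace IsMonotoneSequence

variable {H E : ℕ → ℝ → ℝ} {S : Set ℝ}

theorem shift (h : IsMonotoneSequence H S) : IsMonotoneSequence (fun n => H (n + 1)) S :=
  fun n => h (n + 1)

theorem antitoneOn (h : IsMonotoneSequence H S) (hS : IsOpen S) (hSc : S.OrdConnected) (n : ℕ) :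
    AntitoneOn (H n) S := by
  refine antitoneOn_of_deriv_nonpos hSc.convex
    (fun x hx => (h n x hx).1.continuousAt.continuousWithinAt)
    (fun x hx => ?_) fun x hx => ?_
  all_goals rw [hS.interior_eq] at hx
  · exact (h n x hx).1.differentiableAt.differentiableWithinAt
  · rw [(h n x hx).1.deriv]
    linarith [(h (n + 1) x hx).2]

section UpperSet

variable (hS : IsOpen S) (hup : IsUpperSet S)

/-- A nonnegative function cannot decrease at rate at least `ε` over a length exceeding `H 0 x / ε`.
This replaces the statement that the derivative vanishes at infinity. -/
theorem exists_derivative_lt (h : IsMonotoneSequence H S) (hup : IsUpperSet S) {x ε : ℝ}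
    (hx : x ∈ S) (hε : 0 < ε) : ∃ y, x < y ∧ H 1 y < ε := by
  have hL : x < x + (H 0 x / ε + 1) := by
    have : 0 ≤ H 0 x / ε := div_nonneg (h 0 x hx).2 hε.le
    linarith
  obtain ⟨ξ, hξ, he⟩ := exists_hasDerivAt_eq_slope (H 0) _ hL
    (fun z hz => (h 0 z (hup hz.1 hx)).1.continuousAt.continuousWithinAt)
    (fun z hz => (h 0 z (hup hz.1.le hx)).1)
  refine ⟨ξ, hξ.1, ?_⟩
  have h1 := (h 0 _ (hup hL.le hx)).2
  have h2 : H 0 x / ε * ε = H 0 x := div_mul_cancel₀ _ hε.ne'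
  have h3 : 0 < H 0 x / ε + 1 := by linarith
  rw [eq_div_iff (by linarith)] at he
  by_contra! h4
  nlinarith

include hS hup in
-- A zero of `H 2` persists to its right, as `H 2` is nonnegative and nonincreasing. Then `H 1`
-- would stay constant there, although it must become arbitrarily small.
theorem succ_pos (h : IsMonotoneSequence H S) (h1 : ∀ x ∈ S, 0 < H 1 x) :
    ∀ x ∈ S, 0 < H 2 x := by
  intro x hx
  refine lt_of_le_of_ne (h 2 x hx).2 fun h0 => ?_
  obtain ⟨y, hxy, hy⟩ := h.exists_derivative_lt hup hx (h1 x hx)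
  obtain ⟨ξ, hξ, he⟩ := exists_hasDerivAt_eq_slope (H 1) _ hxy
    (fun z hz => (h 1 z (hup hz.1 hx)).1.continuousAt.continuousWithinAt)
    (fun z hz => (h 1 z (hup hz.1.le hx)).1)
  have h3 := h.antitoneOn hS hup.ordConnected 2 hx (hup hξ.1.le hx) hξ.1.le
  rw [eq_div_iff (by linarith)] at he
  change -H 2 ξ * _ = _ at he
  nlinarith [(h 2 ξ (hup hξ.1.le hx)).2]

include hS hup in
-- Log-convexity up to the factor `(n + 1) / n`, improved by induction over all sequences at once.
-- The weak inequality for the shifted sequence bounds the slope of `H 1 / H 2` below by `-1 / (n +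
-- 1)`; integrating this from `x` to infinity yields the next inequality for `H` itself.
theorem log_convex_approx (n : ℕ) : ∀ {H : ℕ → ℝ → ℝ}, IsMonotoneSequence H S →
    (∀ x ∈ S, 0 < H 1 x) → ∀ x ∈ S, n * H 1 x ^ 2 ≤ (n + 1) * (H 0 x * H 2 x) := by
  induction n with
  | zero =>
    intro H h _ x hx
    have := mul_nonneg (h 0 x hx).2 (h 2 x hx).2
    simpa using this
  | succ n ih =>
    intro H h h1 x hx
    have h2 := h.succ_pos hS hup h1
    have ih' := ih h.shift h2
    set δ : ℝ := 1 / (n + 1) with hδ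
    have hn : (0 : ℝ) < n + 1 := by positivity
    have hδn : δ * (n + 1) = 1 := by rw [hδ]; field_simp
    have hδ0 : 0 < δ := by positivity
    set v : ℝ → ℝ := fun y => H 1 y / H 2 y with hv
    have hIcc : ∀ y ∈ Ici x, y ∈ S := fun y hy => hup hy hx
    have hvd : ∀ y ∈ S, HasDerivAt (fun y => v y + δ * y)
        ((-H 2 y * H 2 y - H 1 y * -H 3 y) / H 2 y ^ 2 + δ) y := fun y hy => by
      have := ((h 1 y hy).1.div (h 2 y hy).1 (h2 y hy).ne').add ((hasDerivAt_id y).const_mul δ)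
      rwa [mul_one] at this
    have hvm : MonotoneOn (fun y => v y + δ * y) (Ici x) := by
      refine monotoneOn_of_deriv_nonneg (convex_Ici x)
        (fun y hy => (hvd y (hIcc y hy)).continuousAt.continuousWithinAt)
        (fun y hy => (hvd y (hIcc y (interior_subset hy))).differentiableAt.differentiableWithinAt)
        fun y hy => ?_
      have hyS := hIcc y (interior_subset hy)
      rw [(hvd y hyS).deriv]
      have h3 := ih' y hyS
      have h4 := h2 y hyS
      have h5 : -δ ≤ (-H 2 y * H 2 y - H 1 y * -H 3 y) / H 2 y ^ 2 := by
        rw [le_div_iff₀ (by positivity)]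
        simp only [zero_add, Nat.reduceAdd] at h3
        have h6 : 0 ≤ δ * ((n + 1) * (H 1 y * H 3 y) - n * H 2 y ^ 2) :=
          mul_nonneg hδ0.le (by linarith)
        have h7 : δ * ((n + 1) * (H 1 y * H 3 y) - n * H 2 y ^ 2)
          = (δ * (n + 1)) * (H 1 y * H 3 y - H 2 y ^ 2) + δ * H 2 y ^ 2 := by ring
        rw [h7, hδn] at h6
        nlinarith
      linarith
    -- The derivative of `G` is `-H 1 y + (v x - δ (y - x)) H 2 y`, which is nonpositive because `v
    -- y ≥ v x - δ (y - x)` and `v H 2 = H 1`. The claim at `x` is `0 ≤ G x`.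
    set G : ℝ → ℝ := fun y => (1 + δ) * H 0 y - (v x - δ * (y - x)) * H 1 y with hG
    have hGd : ∀ y ∈ S, HasDerivAt G
        ((1 + δ) * -H 1 y - (-δ * H 1 y + (v x - δ * (y - x)) * -H 2 y)) y := fun y hy => by
      have hl : HasDerivAt (fun y => v x - δ * (y - x)) (-δ) y := by
        have := (((hasDerivAt_id y).sub_const x).const_mul δ).const_sub (v x)
        rwa [mul_one] at this
      exact ((h 0 y hy).1.const_mul (1 + δ)).sub (hl.mul (h 1 y hy).1)
    have hGa : AntitoneOn G (Ici x) := by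
      refine antitoneOn_of_deriv_nonpos (convex_Ici x)
        (fun y hy => (hGd y (hIcc y hy)).continuousAt.continuousWithinAt)
        (fun y hy => (hGd y (hIcc y (interior_subset hy))).differentiableAt.differentiableWithinAt)
        fun y hy => ?_
      have hyS := hIcc y (interior_subset hy)
      rw [(hGd y hyS).deriv]
      have h3 : v x + δ * x ≤ v y + δ * y := hvm self_mem_Ici (interior_subset hy)
        (interior_subset hy)
      have h4 := h2 y hyS
      have h5 : v y * H 2 y = H 1 y := div_mul_cancel₀ _ h4.ne'
      nlinarith
    have hvx : 0 < v x := div_pos (h1 x hx) (h2 x hx)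
    have hGx : 0 ≤ G x := by
      -- To the right of `x`, `G` stays below `G x < 0`. But its only possibly negative contribution
      -- is `-v x * H 1 y`, which can be made smaller in absolute value than `-G x`.
      by_contra! hneg
      obtain ⟨y, hxy, hy⟩ := h.exists_derivative_lt hup hx
        (div_pos (neg_pos.mpr hneg) hvx)
      have h3 := hGa self_mem_Ici hxy.le hxy.le
      rw [lt_div_iff₀ hvx] at hy
      have h4 := (h 0 y (hup hxy.le hx)).2
      have h5 := h1 y (hup hxy.le hx)
      have h6 : 0 ≤ δ * (y - x) * H 1 y := by
        have : 0 < y - x := by linarith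
        positivity
      have h7 : 0 ≤ (1 + δ) * H 0 y := by positivity
      simp only [hG] at h3 hy
      nlinarith
    have h5 : v x * H 2 x = H 1 x := div_mul_cancel₀ _ (h2 x hx).ne'
    have h6 : G x = (1 + δ) * H 0 x - v x * H 1 x := by simp [hG]
    have h7 : 0 ≤ G x * H 2 x * (n + 1) := mul_nonneg (mul_nonneg hGx (h2 x hx).le) hn.le
    have h8 : G x * H 2 x * (n + 1) =
        (n + 1 + δ * (n + 1)) * (H 0 x * H 2 x) - (v x * H 2 x) * H 1 x * (n + 1) := by
      rw [h6]; ring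
    rw [h8, hδn, h5] at h7
    push_cast
    linarith

include hS hup in
/-- Completely monotone functions on a half-line are logarithmically convex. -/
theorem log_convex (h : IsMonotoneSequence H S) (h1 : ∀ x ∈ S, 0 < H 1 x) {x : ℝ} (hx : x ∈ S) :
    H 1 x ^ 2 ≤ H 0 x * H 2 x := by
  by_contra! hlt
  -- The factor `(n + 1) / n` tends to `1`; this `n` is large enough to contradict a strict failure.
  obtain ⟨n, hn⟩ := exists_nat_gt (H 0 x * H 2 x / (H 1 x ^ 2 - H 0 x * H 2 x))
  rw [div_lt_iff₀ (by linarith)] at hn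
  have := log_convex_approx hS hup n h h1 x hx
  linarith

end UpperSet

/-- In the Taylor expansion of `H m` about `x`, evaluated to the left at `y`, all terms are
nonnegative, so each one is at most `H m y`. These are Cauchy-type estimates, and they are the
source of analyticity. -/
theorem derivative_bound (h : IsMonotoneSequence H S) (hSc : S.OrdConnected) {x y : ℝ}
    (hx : x ∈ S) (hy : y ∈ S) (hyx : y ≤ x) (n m : ℕ) :
    H (m + n) x * (x - y) ^ n / n.factorial ≤ H m y := by
  have hsub := hSc.out hy hx
  suffices ∀ n m, ∀ z ∈ Icc y x, H (m + n) x * (x - z) ^ n / n.factorial ≤ H m z from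
    this n m y ⟨le_rfl, hyx⟩
  intro n
  induction n with
  | zero =>
    intro m z hz
    have hanti : AntitoneOn (H m) (Icc y x) := by
      refine antitoneOn_of_deriv_nonpos (convex_Icc y x)
        (fun t ht => (h m t (hsub ht)).1.continuousAt.continuousWithinAt)
        (fun t ht => (h m t (hsub (interior_subset ht))).1.differentiableAt.differentiableWithinAt)
        fun t ht => ?_
      rw [(h m t (hsub (interior_subset ht))).1.deriv]
      linarith [(h (m + 1) t (hsub (interior_subset ht))).2]
    simpa using hanti hz ⟨hyx, le_rfl⟩ hz.2
  | succ n ih =>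
    intro m z hz
    have hd : ∀ t ∈ Icc y x, HasDerivAt
        (fun t => H m t - H (m + (n + 1)) x * (x - t) ^ (n + 1) / (n + 1).factorial)
        (-H (m + 1) t + H (m + 1 + n) x * (x - t) ^ n / n.factorial) t := fun t ht => by
      have h1 : HasDerivAt (fun t => (x - t) ^ (n + 1)) ((n + 1 : ℕ) * (x - t) ^ n * -1) t :=
        ((hasDerivAt_id t).const_sub x).pow (n + 1)
      refine ((h m t (hsub ht)).1.sub ((h1.const_mul _).div_const _)).congr_deriv ?_
      rw [show m + 1 + n = m + (n + 1) by ring, Nat.factorial_succ]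
      have : (n.factorial : ℝ) ≠ 0 := by positivity
      push_cast
      field_simp
      ring
    have hanti : AntitoneOn
        (fun t => H m t - H (m + (n + 1)) x * (x - t) ^ (n + 1) / (n + 1).factorial)
        (Icc y x) := by
      refine antitoneOn_of_deriv_nonpos (convex_Icc y x)
        (fun t ht => (hd t ht).continuousAt.continuousWithinAt)
        (fun t ht => (hd t (interior_subset ht)).differentiableAt.differentiableWithinAt)
        fun t ht => ?_
      rw [(hd t (interior_subset ht)).deriv]
      linarith [ih (m + 1) t (interior_subset ht)]
    have h2 := hanti hz ⟨hyx, le_rfl⟩ hz.2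
    have h3 := (h m x hx).2
    simp only [sub_self, ne_eq, Nat.add_eq_zero_iff, one_ne_zero, and_false, not_false_eq_true,
      zero_pow, mul_zero, zero_div, sub_zero] at h2
    linarith

end IsMonotoneSequence

/-! ### Taylor remainders and unique continuation -/

theorem abs_le_of_derivatives_eq_zero {g : ℕ → ℝ → ℝ} {a b B : ℝ}
    (hg : ∀ n, ∀ t ∈ Icc a b, HasDerivAt (g n) (g (n + 1) t) t) (h0 : ∀ n, g n a = 0)
    (n : ℕ) : ∀ m, (∀ t ∈ Icc a b, |g (m + n) t| ≤ B) →
      ∀ t ∈ Icc a b, |g m t| ≤ B * (t - a) ^ n / n.factorial := by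
  induction n with
  | zero => intro m hB t ht; simpa using hB t ht
  | succ n ih =>
    intro m hB t ht
    have hb : ∀ t ∈ Icc a b, |g (m + 1) t| ≤ B * (t - a) ^ n / n.factorial :=
      ih (m + 1) (by rwa [show m + 1 + n = m + (n + 1) by ring])
    have hp : ∀ t, HasDerivAt (fun t => B * (t - a) ^ (n + 1) / (n + 1).factorial)
        (B * (t - a) ^ n / n.factorial) t := fun t => by
      have h1 : HasDerivAt (fun t => (t - a) ^ (n + 1)) ((n + 1 : ℕ) * (t - a) ^ n * 1) t :=
        ((hasDerivAt_id t).sub_const a).pow (n + 1)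
      refine ((h1.const_mul B).div_const _).congr_deriv ?_
      rw [Nat.factorial_succ]
      have : (n.factorial : ℝ) ≠ 0 := by positivity
      push_cast
      field_simp
    have hab : a ≤ b := ht.1.trans ht.2
    refine image_norm_le_of_norm_deriv_right_le_deriv_boundary
      (f := g m) (f' := g (m + 1)) (B := fun t => B * (t - a) ^ (n + 1) / (n + 1).factorial)
      (B' := fun t => B * (t - a) ^ n / n.factorial)
      (fun s hs => (hg m s hs).continuousAt.continuousWithinAt)
      (fun s hs => (hg m s ⟨hs.1, hs.2.le⟩).hasDerivWithinAt) ?_ hp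
      (fun s hs => hb s ⟨hs.1, hs.2.le⟩) ht
    simp [h0]

namespace IsMonotoneSequence

variable {H E : ℕ → ℝ → ℝ} {S : Set ℝ}

theorem eventuallyEq_of_derivatives_eq (h : IsMonotoneSequence H S) (e : IsMonotoneSequence E S)
    (hS : IsOpen S) (hSc : S.OrdConnected) {x : ℝ} (hx : x ∈ S) (heq : ∀ n, H n x = E n x) :
    H 0 =ᶠ[𝓝 x] E 0 := by
  obtain ⟨l, u, ⟨hl, hu⟩, hlu⟩ := mem_nhds_iff_exists_Ioo_subset.mp (hS.mem_nhds hx)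
  obtain ⟨y, hy1, hy2⟩ := exists_between hl
  have hyS : y ∈ S := hlu ⟨hy1, hy2.trans hu⟩
  -- Points within `r = (x - y) / 3` of `x` are at distance at least `2 * r` from `y`. The `n`-th
  -- derivatives of the difference are then at most `K n! / (2 r) ^ n`, so the Taylor remainder on
  -- radius `r` is at most `K / 2 ^ n`.
  obtain ⟨r, hr⟩ : ∃ r, r = (x - y) / 3 := ⟨_, rfl⟩
  have hr0 : 0 < r := by rw [hr]; linarith
  set K := H 0 y + E 0 y with hK
  have hK0 : 0 ≤ K := add_nonneg (h 0 y hyS).2 (e 0 y hyS).2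
  have bound : ∀ n, ∀ z ∈ S, x - r ≤ z → |H n z - E n z| ≤ K * n.factorial / (2 * r) ^ n := by
    intro n z hz hzr
    have h1 := h.derivative_bound hSc hz hyS (by linarith) n 0
    have h2 := e.derivative_bound hSc hz hyS (by linarith) n 0
    rw [zero_add, div_le_iff₀ (by positivity)] at h1 h2
    have h3 : (2 * r) ^ n ≤ (z - y) ^ n := pow_le_pow_left₀ (by positivity) (by linarith) n
    have h4 := (h n z hz).2
    have h5 := (e n z hz).2
    rw [le_div_iff₀ (by positivity)]
    have h6 : |H n z - E n z| ≤ H n z + E n z := by rw [abs_le]; constructor <;> linarith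
    calc |H n z - E n z| * (2 * r) ^ n ≤ (H n z + E n z) * (z - y) ^ n := by gcongr
      _ ≤ K * n.factorial := by rw [hK]; linarith
  have zero_of : ∀ d : ℝ, (∀ n : ℕ, |d| ≤ K * (1 / 2) ^ n) → d = 0 := fun d hd => by
    have hlim : Tendsto (fun n : ℕ => K * (1 / 2 : ℝ) ^ n) atTop (𝓝 0) := by
      simpa using (tendsto_pow_atTop_nhds_zero_of_lt_one (r := (1 / 2 : ℝ)) (by norm_num)
        (by norm_num)).const_mul K
    exact abs_nonpos_iff.mp (ge_of_tendsto' hlim hd)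
  have arith : ∀ (n : ℕ) (s : ℝ), 0 ≤ s → s ≤ r →
      K * n.factorial / (2 * r) ^ n * s ^ n / n.factorial ≤ K * (1 / 2) ^ n := by
    intro n s hs hsr
    have h1 : K * n.factorial / (2 * r) ^ n * s ^ n / n.factorial = K * (s / (2 * r)) ^ n := by
      have : (n.factorial : ℝ) ≠ 0 := by positivity
      rw [div_pow]
      field_simp
    rw [h1]
    have : s / (2 * r) ≤ 1 / 2 := by rw [div_le_iff₀ (by positivity)]; linarith
    gcongr
  have hmem : Ioo (max l (x - r)) (min u (x + r)) ∈ 𝓝 x :=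
    Ioo_mem_nhds (max_lt hl (by linarith)) (lt_min hu (by linarith))
  filter_upwards [hmem] with z hz
  have hzl := max_lt_iff.mp hz.1
  have hzu := lt_min_iff.mp hz.2
  have hzS : z ∈ S := hlu ⟨hzl.1, hzu.1⟩
  refine sub_eq_zero.mp (zero_of _ fun n => ?_)
  rcases le_total x z with hxz | hzx
  · have hsub := hSc.out hx hzS
    have := abs_le_of_derivatives_eq_zero (a := x) (b := z)
      (g := fun n t => (-1) ^ n * (H n t - E n t)) (B := K * n.factorial / (2 * r) ^ n)
      (fun n t ht => by
        refine (((h n t (hsub ht)).1.sub (e n t (hsub ht)).1).const_mul ((-1) ^ n)).congr_deriv ?_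
        ring) (fun n => by simp [heq n]) n 0
      (fun t ht => by
        rw [zero_add, abs_mul, abs_pow, abs_neg, abs_one, one_pow, one_mul]
        exact bound n t (hsub ht) (by linarith [ht.1])) z ⟨hxz, le_rfl⟩
    simp only [pow_zero, one_mul] at this
    exact this.trans (arith n _ (by linarith) (by linarith))
  -- The Taylor estimate runs to the right of its base point, so points left of `x` are treated by
  -- reflection, which also absorbs the signs `(-1) ^ n`.
  · have hsub : ∀ t ∈ Icc (-x) (-z), -t ∈ S := fun t ht =>
      hSc.out hzS hx ⟨by linarith [ht.2], by linarith [ht.1]⟩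
    have := abs_le_of_derivatives_eq_zero (a := -x) (b := -z)
      (g := fun n t => H n (-t) - E n (-t)) (B := K * n.factorial / (2 * r) ^ n)
      (fun n t ht => by
        have h1 := ((h n _ (hsub t ht)).1.sub (e n _ (hsub t ht)).1).comp t (hasDerivAt_neg t)
        refine h1.congr_deriv ?_
        ring) (fun n => by simp [heq n]) n 0
      (fun t ht => by
        rw [zero_add]
        exact bound n _ (hsub t ht) (by linarith [ht.2])) (-z) ⟨by linarith, le_rfl⟩
    simp only [neg_neg] at this
    exact this.trans (arith n _ (by linarith) (by linarith))

theorem eqOn_derivatives {V : Set ℝ} (h : IsMonotoneSequence H S) (e : IsMonotoneSequence E S)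
    (hV : IsOpen V) (hVS : V ⊆ S) (heq : EqOn (H 0) (E 0) V) (n : ℕ) : EqOn (H n) (E n) V := by
  induction n with
  | zero => exact heq
  | succ n ih =>
    intro x hx
    have h1 := (h n x (hVS hx)).1
    have h2 := (e n x (hVS hx)).1.congr_of_eventuallyEq (eventuallyEq_of_mem (hV.mem_nhds hx) ih)
    exact neg_injective (h1.unique h2)

/-- Unique continuation for completely monotone functions. -/
theorem eqOn_of_eventuallyEq (h : IsMonotoneSequence H S) (e : IsMonotoneSequence E S)
    (hS : IsOpen S) (hSc : S.OrdConnected) {x : ℝ} (hx : x ∈ S) (heq : H 0 =ᶠ[𝓝 x] E 0) :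
    EqOn (H 0) (E 0) S := by
  set U : Set ℝ := {z | H 0 =ᶠ[𝓝 z] E 0} with hU
  have hUo : IsOpen U := isOpen_iff_mem_nhds.mpr fun z hz => hz.eventuallyEq_nhds
  have hder : ∀ n, EqOn (H n) (E n) (U ∩ S) := h.eqOn_derivatives e (hUo.inter hS)
    inter_subset_right fun z hz => hz.1.self_of_nhds
  have hsub : S ⊆ U := by
    -- The set of local agreement is open, and relatively closed in `S`: at a limit point all
    -- derivatives agree by continuity, which forces agreement nearby.
    refine hSc.isPreconnected.subset_of_closure_inter_subset hUo ⟨x, hx, heq⟩ ?_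
    rintro z ⟨hzU, hzS⟩
    refine h.eventuallyEq_of_derivatives_eq e hS hSc hzS fun n => ?_
    have hcl : z ∈ closure (U ∩ S) := by
      rw [inter_comm]
      exact hS.inter_closure ⟨hzS, hzU⟩
    have hne : (𝓝[U ∩ S] z).NeBot := mem_closure_iff_nhdsWithin_neBot.mp hcl
    refine tendsto_nhds_unique_of_eventuallyEq (l := 𝓝[U ∩ S] z)
      ((h n z hzS).1.continuousAt.tendsto.mono_left nhdsWithin_le_nhds)
      ((e n z hzS).1.continuousAt.tendsto.mono_left nhdsWithin_le_nhds) ?_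
    filter_upwards [self_mem_nhdsWithin] with t ht using hder n ht
  exact fun z hz => (hsub hz).self_of_nhds

end IsMonotoneSequence

theorem isMonotoneSequence_exp {C l : ℝ} (hC : 0 ≤ C) (hl : 0 ≤ l) (S : Set ℝ) :
    IsMonotoneSequence (fun n x => C * l ^ n * Real.exp (-l * x)) S := fun n x _ => by
  refine ⟨?_, by positivity⟩
  have h1 : HasDerivAt (fun x => Real.exp (-l * x)) (Real.exp (-l * x) * (-l * 1)) x :=
    ((hasDerivAt_id x).const_mul (-l)).exp
  refine (h1.const_mul _).congr_deriv ?_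
  ring

/-! ### The theorem: demand satisfying the complete monotonicity criterion -/

section Criterion

variable {P : ℝ → ℝ} {qbar : EReal}

theorem exists_gt_mem_quantityRange {q : ℝ} (hq : q ∈ quantityRange qbar) :
    ∃ b ∈ quantityRange qbar, q < b := by
  obtain ⟨l, u, ⟨hl, hu⟩, hlu⟩ :=
    mem_nhds_iff_exists_Ioo_subset.mp ((isOpen_quantityRange qbar).mem_nhds hq)
  obtain ⟨b, hb1, hb2⟩ := exists_between hu
  exact ⟨b, hlu ⟨hl.trans hb1, hb2⟩, hb1⟩

theorem IsInverseDemand.continuousAt_utility (hP : IsInverseDemand P qbar) {q : ℝ}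
    (hq : q ∈ quantityRange qbar) : ContinuousAt (fun q => ∫ x in (0 : ℝ)..q, P x) q := by
  obtain ⟨b, hb, hqb⟩ := exists_gt_mem_quantityRange hq
  have hint : IntegrableOn P (uIcc 0 b) := by
    rw [uIcc_of_le hb.1.le, integrableOn_Icc_iff_integrableOn_Ioc]
    exact hP.integrable b hb
  refine (intervalIntegral.continuousOn_primitive_interval hint).continuousAt ?_
  rw [uIcc_of_le hb.1.le]
  exact Icc_mem_nhds hq.1 hqb

/-- Regularity is bootstrapped from `P = (U - CS) / q`. Utility `U` is continuous as a primitive, so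
`P` is continuous; then `U` is differentiable, and hence so is `P` when `CS` is. -/
theorem continuousAt_of_consumerSurplus (hP : IsInverseDemand P qbar) {q : ℝ}
    (hq : q ∈ quantityRange qbar) (hc : ContinuousAt (consumerSurplus P) q) :
    ContinuousAt P q := by
  refine (((hP.continuousAt_utility hq).sub hc).div continuousAt_id hq.1.ne').congr ?_
  filter_upwards [Ioi_mem_nhds hq.1] with y hy
  have : y ≠ 0 := ne_of_gt hy
  change ((∫ x in (0 : ℝ)..y, P x) - ((∫ x in (0 : ℝ)..y, P x) - y * P y)) / y = P y
  field_simp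
  ring

theorem hasDerivAt_utility (hP : IsInverseDemand P qbar)
    (hc : ∀ q ∈ quantityRange qbar, ContinuousAt P q) {q : ℝ} (hq : q ∈ quantityRange qbar) :
    HasDerivAt (fun q => ∫ x in (0 : ℝ)..q, P x) (P q) q := by
  refine intervalIntegral.integral_hasDerivAt_right ?_ ?_ (hc q hq)
  · rw [intervalIntegrable_iff_integrableOn_Ioc_of_le hq.1.le]
    exact hP.integrable q hq
  · exact ContinuousOn.stronglyMeasurableAtFilter (isOpen_quantityRange qbar)
      (fun x hx => (hc x hx).continuousWithinAt) q hq

theorem hasDerivAt_of_consumerSurplus (hP : IsInverseDemand P qbar) {k : ℝ → ℝ}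
    (hk : ∀ q ∈ quantityRange qbar, HasDerivAt (consumerSurplus P) (k q) q) {q : ℝ}
    (hq : q ∈ quantityRange qbar) : HasDerivAt P (-k q / q) q := by
  have hc : ∀ q ∈ quantityRange qbar, ContinuousAt P q := fun q hq =>
    continuousAt_of_consumerSurplus hP hq (hk q hq).continuousAt
  have h1 := (((hasDerivAt_utility hP hc hq).sub (hk q hq)).div (hasDerivAt_id q) hq.1.ne')
  refine (h1.congr_deriv ?_).congr_of_eventuallyEq ?_
  · have : q ≠ 0 := hq.1.ne'
    simp only [Pi.sub_apply, consumerSurplus, id]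
    field_simp
    ring
  · filter_upwards [Ioi_mem_nhds hq.1] with y hy
    have : y ≠ 0 := ne_of_gt hy
    simp only [Pi.div_apply, Pi.sub_apply, consumerSurplus, id]
    field_simp
    ring

/-- The range of minus log quantity. -/
def negLogRange (qbar : EReal) : Set ℝ := {x : ℝ | Real.exp (-x) ∈ quantityRange qbar}

theorem isOpen_negLogRange (qbar : EReal) : IsOpen (negLogRange qbar) :=
  (isOpen_quantityRange qbar).preimage (by fun_prop)

theorem isUpperSet_negLogRange (qbar : EReal) : IsUpperSet (negLogRange qbar) :=
  fun _ _ hxy hx => quantityRange_mem_of_le hx (Real.exp_pos _) (Real.exp_le_exp.mpr (by linarith))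

theorem neg_log_mem_negLogRange {q : ℝ} (hq : q ∈ quantityRange qbar) :
    -Real.log q ∈ negLogRange qbar := by
  rw [negLogRange, mem_ofPred_eq, neg_neg, Real.exp_log hq.1]
  exact hq

variable {H : ℕ → ℝ → ℝ}

theorem hasDerivAt_comp_neg_log (hH : IsMonotoneSequence H (negLogRange qbar)) (n : ℕ) {q : ℝ}
    (hq : q ∈ quantityRange qbar) :
    HasDerivAt (fun q => H n (-Real.log q)) (H (n + 1) (-Real.log q) / q) q := by
  refine ((hH n _ (neg_log_mem_negLogRange hq)).1.comp q
    (Real.hasDerivAt_log hq.1.ne').neg).congr_deriv ?_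
  rw [neg_mul_neg, div_eq_mul_inv]

variable (hP : IsInverseDemand P qbar) (hH : IsMonotoneSequence H (negLogRange qbar))
  (h0 : ∀ q ∈ quantityRange qbar, H 0 (-Real.log q) = consumerSurplus P q)

include hP hH h0

theorem hasDerivAt_inverseDemand {q : ℝ} (hq : q ∈ quantityRange qbar) :
    HasDerivAt P (-H 1 (-Real.log q) / q ^ 2) q := by
  have hk : ∀ q ∈ quantityRange qbar,
      HasDerivAt (consumerSurplus P) (H 1 (-Real.log q) / q) q := fun q hq => by
    refine (hasDerivAt_comp_neg_log hH 0 hq).congr_of_eventuallyEq ?_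
    filter_upwards [(isOpen_quantityRange qbar).mem_nhds hq] with y hy using (h0 y hy).symm
  refine (hasDerivAt_of_consumerSurplus hP hk hq).congr_deriv ?_
  have : q ≠ 0 := hq.1.ne'
  field_simp

/-- A zero of `H 1` persists to its right, that is, at all smaller quantities. There `P' = 0`,
contradicting strict monotonicity of demand. -/
theorem derivative_pos {x : ℝ} (hx : x ∈ negLogRange qbar) : 0 < H 1 x := by
  refine lt_of_le_of_ne (hH 1 x hx).2 fun hx0 => ?_
  have hmem : ∀ q ∈ Ioc 0 (Real.exp (-x)), q ∈ quantityRange qbar := fun q hq =>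
    quantityRange_mem_of_le hx hq.1 hq.2
  have hz : ∀ q ∈ Ioc 0 (Real.exp (-x)), H 1 (-Real.log q) = 0 := fun q hq => by
    have hS := neg_log_mem_negLogRange (hmem q hq)
    refine le_antisymm ?_ (hH 1 _ hS).2
    rw [hx0]
    refine hH.antitoneOn (isOpen_negLogRange qbar) (isUpperSet_negLogRange qbar).ordConnected 1
      hx hS ?_
    have := (Real.log_le_iff_le_exp hq.1).mpr hq.2
    linarith
  obtain ⟨a, ha1, ha2⟩ := exists_between (Real.exp_pos (-x))
  have hIcc : ∀ q ∈ Icc a (Real.exp (-x)), q ∈ Ioc 0 (Real.exp (-x)) := fun q hq =>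
    ⟨ha1.trans_le hq.1, hq.2⟩
  obtain ⟨ξ, hξ, he⟩ := exists_hasDerivAt_eq_slope P _ ha2
    (fun z hz => (hasDerivAt_inverseDemand hP hH h0
      (hmem z (hIcc z hz))).continuousAt.continuousWithinAt)
    (fun z hz => hasDerivAt_inverseDemand hP hH h0 (hmem z (hIcc z (Ioo_subset_Icc_self hz))))
  rw [hz ξ (hIcc ξ (Ioo_subset_Icc_self hξ)), neg_zero, zero_div, eq_div_iff (by linarith),
    zero_mul] at he
  have := hP.strictAnti (hmem a ⟨ha1, ha2.le⟩) hx ha2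
  linarith

theorem exists_eq_exp_of_derivative_ratio {x y l : ℝ} (hx : x ∈ negLogRange qbar)
    (hl : ∀ z ∈ Ioo x y, H 2 z = l * H 1 z) :
    ∃ C, 0 < C ∧ ∀ z ∈ Ioo x y, H 1 z = C * Real.exp (-l * z) := by
  by_cases hxy : x < y
  swap
  · exact ⟨1, one_pos, fun z hz => absurd (hz.1.trans hz.2) hxy⟩
  have hS : ∀ z ∈ Ioo x y, z ∈ negLogRange qbar := fun z hz =>
    isUpperSet_negLogRange qbar hz.1.le hx
  obtain ⟨c, hc⟩ := exists_between hxy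
  -- Integrating factor for the equation `(H 1)' = -l * H 1`.
  have hd : ∀ z ∈ Ioo x y, HasDerivAt (fun z => H 1 z * Real.exp (l * z)) 0 z := fun z hz => by
    have h1 : HasDerivAt (fun x => Real.exp (l * x)) (Real.exp (l * z) * (l * 1)) z :=
      ((hasDerivAt_id z).const_mul l).exp
    refine ((hH 1 z (hS z hz)).1.mul h1).congr_deriv ?_
    rw [hl z hz]
    ring
  refine ⟨H 1 c * Real.exp (l * c),
    mul_pos (derivative_pos hP hH h0 (hS c hc)) (Real.exp_pos _), fun z hz => ?_⟩
  have := isOpen_Ioo.is_const_of_deriv_eq_zero isPreconnected_Ioo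
    (fun t ht => (hd t ht).differentiableAt.differentiableWithinAt)
    (fun t ht => (hd t ht).deriv) hc hz
  rw [this, mul_assoc, ← Real.exp_add]
  simp

theorem isBulowPfleiderer_of_exp {C l : ℝ}
    (hexp : ∀ x ∈ negLogRange qbar, H 1 x = C * Real.exp (-l * x)) :
    IsBulowPfleiderer P (quantityRange qbar) := by
  set D := quantityRange qbar
  have hD : IsOpen D := isOpen_quantityRange qbar
  have hDc : IsPreconnected D := (ordConnected_quantityRange qbar).isPreconnected
  have hPd : ∀ q ∈ D, HasDerivAt P (-C * q ^ (l - 2)) q := fun q hq => by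
    refine (hasDerivAt_inverseDemand hP hH h0 hq).congr_deriv ?_
    rw [hexp _ (neg_log_mem_negLogRange hq), Real.rpow_sub hq.1, Real.rpow_def_of_pos hq.1]
    norm_cast
    rw [neg_mul_neg, mul_comm l]
    ring
  have key : ∀ F : ℝ → ℝ, (∀ q ∈ D, HasDerivAt F (-C * q ^ (l - 2)) q) →
      ∃ k, ∀ q ∈ D, P q = k + F q := fun F hF => by
    rcases D.eq_empty_or_nonempty with he | ⟨q₀, hq₀⟩
    · exact ⟨0, by simp [he]⟩
    refine ⟨P q₀ - F q₀, fun q hq => ?_⟩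
    have hd : ∀ q ∈ D, HasDerivAt (fun q => P q - F q) 0 q := fun q hq =>
      ((hPd q hq).sub (hF q hq)).congr_deriv (sub_self _)
    have := hD.is_const_of_deriv_eq_zero hDc
      (fun t ht => (hd t ht).differentiableAt.differentiableWithinAt)
      (fun t ht => (hd t ht).deriv) hq₀ hq
    linarith
  by_cases hl : l = 1
  · right
    obtain ⟨k, hk⟩ := key (fun q => -(C * Real.log q)) fun q hq => by
      refine ((Real.hasDerivAt_log hq.1.ne').const_mul C).neg.congr_deriv ?_
      rw [hl, show (1 : ℝ) - 2 = -1 by norm_num, Real.rpow_neg_one]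
      ring
    exact ⟨k, C, fun q hq => by rw [hk q hq]; ring⟩
  · left
    have hl1 : l - 1 ≠ 0 := sub_ne_zero.mpr hl
    obtain ⟨k, hk⟩ := key (fun q => -C / (l - 1) * q ^ (-(1 - l))) fun q hq => by
      refine ((Real.hasDerivAt_rpow_const (Or.inl hq.1.ne')).const_mul _).congr_deriv ?_
      rw [show -(1 - l) - 1 = l - 2 by ring]
      field_simp
      ring
    exact ⟨k, _, _, hk⟩

/-- The sign of the derivative is that of `H 2 ^ 2 - H 1 * H 3`, so this is log-convexity of `H 1`,
applied to the shifted sequence. -/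
theorem antitoneOn_derivative_ratio :
    AntitoneOn (fun x => H 2 x / H 1 x) (negLogRange qbar) := by
  set S := negLogRange qbar
  have hS : IsOpen S := isOpen_negLogRange qbar
  have hup : IsUpperSet S := isUpperSet_negLogRange qbar
  have h1 : ∀ x ∈ S, 0 < H 1 x := fun x hx => derivative_pos hP hH h0 hx
  have h2 : ∀ x ∈ S, 0 < H 2 x := hH.succ_pos hS hup h1
  have hd : ∀ x ∈ S, HasDerivAt (fun x => H 2 x / H 1 x)
      ((-H 3 x * H 1 x - H 2 x * -H 2 x) / H 1 x ^ 2) x := fun x hx =>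
    (hH 2 x hx).1.div (hH 1 x hx).1 (h1 x hx).ne'
  refine antitoneOn_of_deriv_nonpos hup.ordConnected.convex
    (fun x hx => (hd x hx).continuousAt.continuousWithinAt)
    (fun x hx => ?_) fun x hx => ?_
  all_goals rw [hS.interior_eq] at hx
  · exact (hd x hx).differentiableAt.differentiableWithinAt
  · rw [(hd x hx).deriv]
    refine div_nonpos_of_nonpos_of_nonneg ?_ (by positivity)
    have := hH.shift.log_convex hS hup h2 hx
    simp only [zero_add, Nat.reduceAdd] at this
    linarith

/-- Equal values at two points make the monotone ratio constant in between, so `H 1` is exponential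
on an interval, by unique continuation everywhere, and demand is BP. -/
theorem strictAntiOn_derivative_ratio (hBP : ¬ IsBulowPfleiderer P (quantityRange qbar)) :
    StrictAntiOn (fun x => H 2 x / H 1 x) (negLogRange qbar) := by
  have hanti := antitoneOn_derivative_ratio hP hH h0
  have hS : IsOpen (negLogRange qbar) := isOpen_negLogRange qbar
  have hup : IsUpperSet (negLogRange qbar) := isUpperSet_negLogRange qbar
  intro x hx y hy hxy
  refine lt_of_le_of_ne (hanti hx hy hxy.le) fun heq => hBP ?_
  set l := H 2 x / H 1 x with hl
  have hmem : ∀ z ∈ Ioo x y, z ∈ negLogRange qbar := fun z hz => hup hz.1.le hx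
  have hl0 : 0 ≤ l := div_nonneg (hH 2 x hx).2 (hH 1 x hx).2
  obtain ⟨C, hC, hexp⟩ := exists_eq_exp_of_derivative_ratio hP hH h0 (y := y) (l := l) hx
    fun z hz => by
      have h1 : H 2 z / H 1 z = l := le_antisymm (hanti hx (hmem z hz) hz.1.le)
        (heq.symm.trans_le (hanti (hmem z hz) hy hz.2.le))
      rw [← h1, div_mul_cancel₀ _ (derivative_pos hP hH h0 (hmem z hz)).ne']
  obtain ⟨c, hc⟩ := exists_between hxy
  refine isBulowPfleiderer_of_exp hP hH h0 (C := C) (l := l) fun z hz => ?_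
  have := hH.shift.eqOn_of_eventuallyEq (isMonotoneSequence_exp hC.le hl0 _) hS
    hup.ordConnected (hmem c hc) (by
      filter_upwards [isOpen_Ioo.mem_nhds hc] with t ht
      simpa using hexp t ht) hz
  simpa using this

theorem hasDerivAt_deriv_inverseDemand {q : ℝ} (hq : q ∈ quantityRange qbar) :
    HasDerivAt (fun q => -H 1 (-Real.log q) / q ^ 2)
      (-H 1 (-Real.log q) / q ^ 2 * (H 2 (-Real.log q) / H 1 (-Real.log q) - 2) / q) q := by
  have h1 := (derivative_pos hP hH h0 (neg_log_mem_negLogRange hq)).ne'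
  have hq0 : q ≠ 0 := hq.1.ne'
  refine ((hasDerivAt_comp_neg_log hH 1 hq).neg.div (hasDerivAt_pow 2 q)
    (pow_ne_zero 2 hq0)).congr_deriv ?_
  simp only [Pi.neg_apply]
  field_simp
  norm_num
  ring

omit hP hH h0 in
theorem passThrough_of_criterion (hP : IsInverseDemand P qbar)
    (hcrit : CompleteMonotonicityCriterion P qbar) :
    (¬ IsBulowPfleiderer P (quantityRange qbar) →
      DecreasingPassThrough P (quantityRange qbar)) ∧
    (IsBulowPfleiderer P (quantityRange qbar) → ConstantPassThrough P (quantityRange qbar)) := by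
  obtain ⟨H, hH, h0⟩ : ∃ H : ℕ → ℝ → ℝ, IsMonotoneSequence H (negLogRange qbar) ∧
      ∀ q ∈ quantityRange qbar, H 0 (-Real.log q) = consumerSurplus P q :=
    ⟨_, hcrit.isMonotoneSequence (isOpen_negLogRange qbar), fun q hq => by
      simp [Real.exp_log hq.1]⟩
  have hD := isOpen_quantityRange qbar
  have hDc := ordConnected_quantityRange qbar
  have hS := isOpen_negLogRange qbar
  have hup := isUpperSet_negLogRange qbar
  have hp : ∀ q ∈ quantityRange qbar, HasDerivAt P (-H 1 (-Real.log q) / q ^ 2) q :=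
    fun q hq => hasDerivAt_inverseDemand hP hH h0 hq
  have hp' : ∀ q ∈ quantityRange qbar, HasDerivAt (fun q => -H 1 (-Real.log q) / q ^ 2)
      (-H 1 (-Real.log q) / q ^ 2 * (H 2 (-Real.log q) / H 1 (-Real.log q) - 2) / q) q :=
    fun q hq => hasDerivAt_deriv_inverseDemand hP hH h0 hq
  have h1 : ∀ q ∈ quantityRange qbar, 0 < H 1 (-Real.log q) := fun q hq =>
    derivative_pos hP hH h0 (neg_log_mem_negLogRange hq)
  have hneg : ∀ q ∈ quantityRange qbar, -H 1 (-Real.log q) / q ^ 2 < 0 := fun q hq =>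
    div_neg_of_neg_of_pos (neg_neg_of_pos (h1 q hq)) (pow_pos hq.1 2)
  have hw : ∀ q ∈ quantityRange qbar, -2 < H 2 (-Real.log q) / H 1 (-Real.log q) - 2 :=
    fun q hq => by
      have := div_pos (hH.succ_pos hS hup (fun x hx => derivative_pos hP hH h0 hx) _
        (neg_log_mem_negLogRange hq)) (h1 q hq)
      linarith
  constructor
  · intro hBP
    refine decreasingPassThrough_of_curvature hD hDc (fun q hq => hq.1) hp hneg hp' hw ?_
    intro a ha b hb hab
    have := strictAntiOn_derivative_ratio hP hH h0 hBP (neg_log_mem_negLogRange hb)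
      (neg_log_mem_negLogRange ha) (neg_lt_neg (Real.log_lt_log ha.1 hab))
    simp only at this
    linarith
  · intro hBP
    -- Both forms of BP demand have a slope that is a multiple of a power of `q`, whose elasticity
    -- is the exponent. The bound `-2 < w₀` comes from the criterion, not from the parameters.
    obtain ⟨w₀, B, hder⟩ : ∃ w₀ B : ℝ, ∀ q ∈ quantityRange qbar,
        HasDerivAt P (B * q ^ w₀) q := by
      rcases hBP with ⟨p₀, pt, t, h⟩ | ⟨a, b, h⟩
      · refine ⟨-t - 1, pt * -t, fun q hq => ?_⟩
        refine ((((Real.hasDerivAt_rpow_const (p := -t) (Or.inl hq.1.ne')).const_mul pt).const_add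
          p₀).congr_deriv (by ring)).congr_of_eventuallyEq ?_
        filter_upwards [hD.mem_nhds hq] with y hy using h y hy
      · refine ⟨-1, -b, fun q hq => ?_⟩
        refine ((((Real.hasDerivAt_log hq.1.ne').const_mul b).const_sub
          a).congr_deriv (by rw [Real.rpow_neg_one]; ring)).congr_of_eventuallyEq ?_
        filter_upwards [hD.mem_nhds hq] with y hy using h y hy
    have hwq : ∀ q ∈ quantityRange qbar,
        H 2 (-Real.log q) / H 1 (-Real.log q) - 2 = w₀ := fun q hq => by
      have heq : ∀ y ∈ quantityRange qbar, -H 1 (-Real.log y) / y ^ 2 = B * y ^ w₀ := fun y hy =>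
        (hp y hy).unique (hder y hy)
      have h3 : HasDerivAt (fun q => -H 1 (-Real.log q) / q ^ 2) (B * (w₀ * q ^ (w₀ - 1))) q := by
        refine ((Real.hasDerivAt_rpow_const (Or.inl hq.1.ne')).const_mul B).congr_of_eventuallyEq ?_
        filter_upwards [hD.mem_nhds hq] with y hy using heq y hy
      have h4 := (hp' q hq).unique h3
      rw [Real.rpow_sub_one hq.1.ne', show B * (w₀ * (q ^ w₀ / q)) = B * q ^ w₀ * w₀ / q by ring,
        ← heq q hq, div_left_inj' hq.1.ne'] at h4
      exact mul_left_cancel₀ (hneg q hq).ne h4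
    rcases (quantityRange qbar).eq_empty_or_nonempty with he | ⟨q₀, hq₀⟩
    · exact ⟨0, fun q hq => by simp [he] at hq⟩
    refine constantPassThrough_of_curvature (w₀ := w₀) hD hDc (fun q hq => hq.1) hp hneg
      (fun q hq => ?_) (hwq q₀ hq₀ ▸ hw q₀ hq₀)
    have := hp' q hq
    rwa [hwq q hq] at this

end Criterion

/-! ### Calculus criteria for explicit demand functions -/

section Criteria

variable {P : ℝ → ℝ}

theorem constantPassThrough_of_power_deriv {D : Set ℝ} (hD : IsOpen D) (hDc : D.OrdConnected)
    (hpos : ∀ q ∈ D, 0 < q) {B w : ℝ} (hB : B < 0) (hw : -2 < w)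
    (hP : ∀ q ∈ D, HasDerivAt P (B * q ^ w) q) : ConstantPassThrough P D := by
  refine constantPassThrough_of_curvature (w₀ := w) hD hDc hpos hP
    (fun q hq => mul_neg_of_neg_of_pos hB (Real.rpow_pos_of_pos (hpos q hq) _))
    (fun q hq => ?_) hw
  refine ((Real.hasDerivAt_rpow_const (Or.inl (hpos q hq).ne')).const_mul B).congr_deriv ?_
  rw [Real.rpow_sub_one (hpos q hq).ne']
  ring

theorem constantPassThrough_of_affine_rpow {D : Set ℝ} (hD : IsOpen D) (hDc : D.OrdConnected)
    (hpos : ∀ q ∈ D, 0 < q) {a b s : ℝ} (hbs : b * s < 0) (hs : -1 < s)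
    (hP : ∀ q, P q = a + b * q ^ s) : ConstantPassThrough P D := by
  refine constantPassThrough_of_power_deriv (w := s - 1) hD hDc hpos hbs (by linarith)
    fun q hq => ?_
  rw [show P = fun q => a + b * q ^ s from funext hP]
  refine (((Real.hasDerivAt_rpow_const (Or.inl (hpos q hq).ne')).const_mul b).const_add
    a).congr_deriv ?_
  ring

theorem decreasingPassThrough_unit_of_curvature {p w : ℝ → ℝ}
    (hP : ∀ q ∈ Ioo (0 : ℝ) 1, HasDerivAt P (p q) q) (hneg : ∀ q ∈ Ioo (0 : ℝ) 1, p q < 0)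
    (hp : ∀ q ∈ Ioo (0 : ℝ) 1, HasDerivAt p (p q * w q / q) q)
    (hw : ∀ q ∈ Ioo (0 : ℝ) 1, -2 < w q) (hmono : StrictMonoOn w (Ioo 0 1)) :
    DecreasingPassThrough P (Ioo 0 1) :=
  decreasingPassThrough_of_curvature isOpen_Ioo ordConnected_Ioo (fun _ hq => hq.1) hP hneg hp hw
    hmono

/-- Decreasing pass-through for demand of the form `a + b * z q ^ s`. -/
theorem decreasingPassThrough_of_rpow_comp {z z₁ z₂ w : ℝ → ℝ} {a b s : ℝ}
    (hP : ∀ q, P q = a + b * z q ^ s) (hz : ∀ q ∈ Ioo (0 : ℝ) 1, HasDerivAt z (z₁ q) q)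
    (hz₁ : ∀ q ∈ Ioo (0 : ℝ) 1, HasDerivAt z₁ (z₂ q) q) (hz0 : ∀ q ∈ Ioo (0 : ℝ) 1, 0 < z q)
    (hneg : ∀ q ∈ Ioo (0 : ℝ) 1, b * s * z₁ q < 0)
    (hwz : ∀ q ∈ Ioo (0 : ℝ) 1, w q = q * ((s - 1) * z₁ q / z q + z₂ q / z₁ q))
    (hw : ∀ q ∈ Ioo (0 : ℝ) 1, -2 < w q) (hmono : StrictMonoOn w (Ioo 0 1)) :
    DecreasingPassThrough P (Ioo 0 1) := by
  refine decreasingPassThrough_unit_of_curvature (p := fun q => b * s * z₁ q * z q ^ (s - 1))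
    (fun q hq => ?_)
    (fun q hq => mul_neg_of_neg_of_pos (hneg q hq) (Real.rpow_pos_of_pos (hz0 q hq) _))
    (fun q hq => ?_) hw hmono
  · rw [show P = fun q => a + b * z q ^ s from funext hP]
    refine ((((hz q hq).rpow_const (Or.inl (hz0 q hq).ne')).const_mul b).const_add
      a).congr_deriv ?_
    ring
  · refine (((hz₁ q hq).const_mul (b * s)).mul
      ((hz q hq).rpow_const (Or.inl (hz0 q hq).ne'))).congr_deriv ?_
    have h1 : z₁ q ≠ 0 := fun h0 => by simpa [h0] using hneg q hq
    have h2 := (hz0 q hq).ne'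
    have h3 := hq.1.ne'
    rw [hwz q hq, Real.rpow_sub_one h2 (s - 1)]
    field_simp
    ring

theorem div_add_lt_div_add {x₁ x₂ y₁ y₂ : ℝ} (hx : 0 < x₂) (hx12 : x₂ ≤ x₁) (hy : 0 < y₁)
    (hy12 : y₁ < y₂) : y₁ / (x₁ + y₁) < y₂ / (x₂ + y₂) := by
  rw [div_lt_div_iff₀ (by linarith) (by linarith)]
  nlinarith

theorem div_one_sub_lt_div_one_sub {a b : ℝ} (hb : b < 1) (hab : a < b) :
    a / (1 - a) < b / (1 - b) := by
  rw [div_lt_div_iff₀ (by linarith) (by linarith)]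
  linarith

theorem hasDerivAt_one_sub (q : ℝ) : HasDerivAt (fun q : ℝ => 1 - q) (-1) q :=
  (hasDerivAt_id q).const_sub 1

theorem hasDerivAt_one_div_one_sub {q : ℝ} (hq : 1 - q ≠ 0) :
    HasDerivAt (fun q : ℝ => 1 / (1 - q)) (1 / (1 - q) ^ 2) q := by
  simpa using (hasDerivAt_one_sub q).fun_inv hq

end Criteria

/-! ### Demand functions with elementary curvature -/

section Examples

theorem constantElasticity_passThrough {β ε : ℝ} (qbar : EReal) (hβ : 0 < β) (hε : 1 < ε) :
    ConstantPassThrough (constantElasticity β ε) (quantityRange qbar) := by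
  have h1 : 1 / ε < 1 := (div_lt_one (by linarith)).mpr hε
  have h2 : 0 < 1 / ε := by positivity
  exact constantPassThrough_of_affine_rpow (a := 0) (b := β) (s := -(1 / ε))
    (isOpen_quantityRange _) (ordConnected_quantityRange _) (fun _ hq => hq.1)
    (by nlinarith) (by linarith) fun q => (zero_add _).symm

theorem constantPassThroughDemand_passThrough {μ β ε : ℝ} (qbar : EReal) (hβ : 0 < β)
    (hε : 1 < ε) : ConstantPassThrough (constantPassThroughDemand μ β ε) (quantityRange qbar) := by
  have h1 : 1 / ε < 1 := (div_lt_one (by linarith)).mpr hε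
  have h2 : 0 < 1 / ε := by positivity
  exact constantPassThrough_of_affine_rpow (a := μ) (b := β) (s := -(1 / ε))
    (isOpen_quantityRange _) (ordConnected_quantityRange _) (fun _ hq => hq.1)
    (by nlinarith) (by linarith) fun q => rfl

theorem generalizedPareto_passThrough {μ σ γ : ℝ} (hσ : 0 < σ) (hγ : γ < 1) :
    ConstantPassThrough (generalizedPareto μ σ γ) (Ioo 0 1) := by
  by_cases h0 : γ = 0
  · subst h0
    refine constantPassThrough_of_power_deriv (B := -σ) (w := -1) isOpen_Ioo ordConnected_Ioo
      (fun q hq => hq.1) (by linarith) (by norm_num) fun q hq => ?_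
    rw [show generalizedPareto μ σ 0 = fun q => μ - σ * Real.log q from
      funext fun q => if_pos rfl]
    refine (((Real.hasDerivAt_log hq.1.ne').const_mul σ).const_sub μ).congr_deriv ?_
    rw [Real.rpow_neg_one]
    ring
  · refine constantPassThrough_of_affine_rpow (a := μ - σ / γ) (b := σ / γ) (s := -γ)
      isOpen_Ioo ordConnected_Ioo (fun _ hq => hq.1) ?_ (by linarith) fun q => ?_
    · rw [show σ / γ * -γ = -σ by field_simp]
      linarith
    · rw [generalizedPareto, if_neg h0]
      ring

theorem logistic_passThrough {μ β : ℝ} (hβ : 0 < β) :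
    DecreasingPassThrough (logistic μ β) (Ioo 0 1) := by
  refine decreasingPassThrough_unit_of_curvature (p := fun q => -β / (q * (1 - q)))
    -- Minus the elasticity of `q (1 - q)`, the reciprocal of the slope up to a factor.
    (w := fun q => -1 + q / (1 - q)) (fun q hq => ?_) (fun q hq => ?_) (fun q hq => ?_)
    (fun q hq => ?_) fun a ha b hb hab => ?_
  · have h1 : 0 < 1 - q := by linarith [hq.2]
    have h2 := hq.1
    have h3 : 1 / (1 - q) - 1 = q / (1 - q) := by field_simp; ring
    have h4 : 1 / (1 - q) - 1 ≠ 0 := by rw [h3]; positivity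
    refine ((((hasDerivAt_one_div_one_sub h1.ne').sub_const 1).log h4).const_mul β).const_sub μ
      |>.congr_deriv ?_
    rw [h3]
    field_simp
  · have h1 : 0 < 1 - q := by linarith [hq.2]
    have h2 := hq.1
    exact div_neg_of_neg_of_pos (by linarith) (by positivity)
  · have h1 : 0 < 1 - q := by linarith [hq.2]
    have h2 := hq.1
    refine ((hasDerivAt_const q (-β)).div ((hasDerivAt_id q).mul (hasDerivAt_one_sub q))
      (by simp only [Pi.mul_apply, id]; positivity)).congr_deriv ?_
    simp only [Pi.mul_apply, id]
    field_simp
    ring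
  · have h1 : 0 < 1 - q := by linarith [hq.2]
    have := div_pos hq.1 h1
    linarith
  · have := div_one_sub_lt_div_one_sub hb.2 hab
    simp only
    linarith

theorem logLogistic_passThrough {γ σ : ℝ} (hγ : 1 < γ) (hσ : 0 < σ) :
    DecreasingPassThrough (logLogistic γ σ) (Ioo 0 1) := by
  have hγ1 : 1 / γ < 1 := (div_lt_one (by linarith)).mpr hγ
  have hγ0 : 0 < 1 / γ := by positivity
  obtain ⟨t, ht⟩ : ∃ t, t = 1 / γ := ⟨_, rfl⟩
  rw [← ht] at hγ1 hγ0
  refine decreasingPassThrough_of_rpow_comp (a := 0) (b := σ) (s := -t)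
    (z := fun q => q / (1 - q)) (z₁ := fun q => 1 / (1 - q) ^ 2) (z₂ := fun q => 2 / (1 - q) ^ 3)
    (w := fun q => -t - 1 + (1 - t) * (q / (1 - q)))
    (fun q => by rw [logLogistic, ht, zero_add]) (fun q hq => ?_) (fun q hq => ?_) (fun q hq => ?_)
    (fun q hq => ?_) (fun q hq => ?_) (fun q hq => ?_) fun a ha b hb hab => ?_
  · have h1 : 0 < 1 - q := by linarith [hq.2]
    refine ((hasDerivAt_id q).div (hasDerivAt_one_sub q) h1.ne').congr_deriv ?_
    simp only [id]
    field_simp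
    ring
  · have h1 : 0 < 1 - q := by linarith [hq.2]
    refine ((hasDerivAt_const q (1 : ℝ)).div ((hasDerivAt_one_sub q).pow 2)
      (pow_ne_zero 2 h1.ne')).congr_deriv ?_
    simp only [Pi.pow_apply]
    field_simp
    norm_num
    ring
  · exact div_pos hq.1 (by linarith [hq.2])
  · have h1 : 0 < 1 - q := by linarith [hq.2]
    exact mul_neg_of_neg_of_pos (by nlinarith) (by positivity)
  · have h1 : 0 < 1 - q := by linarith [hq.2]
    have h2 := hq.1
    field_simp
    ring
  · have := mul_pos (sub_pos.mpr hγ1) (div_pos hq.1 (sub_pos.mpr hq.2))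
    linarith
  · have := mul_lt_mul_of_pos_left (div_one_sub_lt_div_one_sub hb.2 hab) (sub_pos.mpr hγ1)
    simp only
    linarith

theorem one_div_neg_log_lt {a b : ℝ} (ha : 0 < a) (hb : b < 1) (hab : a < b) :
    1 / -Real.log a < 1 / -Real.log b :=
  one_div_lt_one_div_of_lt (neg_pos.mpr (Real.log_neg (ha.trans hab) hb))
    (neg_lt_neg (Real.log_lt_log ha hab))

theorem gumbel_passThrough {α β : ℝ} (hβ : 0 < β) :
    DecreasingPassThrough (gumbel α β) (Ioo 0 1) := by
  refine decreasingPassThrough_unit_of_curvature (p := fun q => β / (q * Real.log q))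
    (w := fun q => -1 + 1 / -Real.log q) (fun q hq => ?_) (fun q hq => ?_) (fun q hq => ?_)
    (fun q hq => ?_) fun a ha b hb hab => ?_
  · have h1 := Real.log_neg hq.1 hq.2
    have h2 := hq.1.ne'
    refine ((((Real.hasDerivAt_log h2).neg.log (neg_pos.mpr h1).ne').const_mul β).const_add
      α).congr_deriv ?_
    have h3 := h1.ne
    simp only [Pi.neg_apply]
    field_simp
  · exact div_neg_of_pos_of_neg hβ (mul_neg_of_pos_of_neg hq.1 (Real.log_neg hq.1 hq.2))
  · have h1 := (Real.log_neg hq.1 hq.2).ne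
    have h2 := hq.1.ne'
    refine ((hasDerivAt_const q β).div ((hasDerivAt_id q).mul (Real.hasDerivAt_log h2))
      (mul_ne_zero h2 h1)).congr_deriv ?_
    simp only [Pi.mul_apply, id]
    field_simp
    ring
  · have := one_div_pos.mpr (neg_pos.mpr (Real.log_neg hq.1 hq.2))
    linarith
  · have := one_div_neg_log_lt ha.1 hb.2 hab
    simp only
    linarith

theorem weibull_passThrough {α β : ℝ} (hα : 1 < α) (hβ : 0 < β) :
    DecreasingPassThrough (weibull α β) (Ioo 0 1) := by
  have hα1 : 1 / α < 1 := (div_lt_one (by linarith)).mpr hα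
  have hα0 : 0 < 1 / α := by positivity
  obtain ⟨t, ht⟩ : ∃ t, t = 1 / α := ⟨_, rfl⟩
  rw [← ht] at hα1 hα0
  refine decreasingPassThrough_of_rpow_comp (a := 0) (b := β) (s := t)
    (z := fun q => -Real.log q) (z₁ := fun q => -q⁻¹) (z₂ := fun q => (q ^ 2)⁻¹)
    (w := fun q => -1 + (1 - t) * (1 / -Real.log q))
    (fun q => by rw [weibull, ht, zero_add]) (fun q hq => ?_) (fun q hq => ?_) (fun q hq => ?_)
    (fun q hq => ?_) (fun q hq => ?_) (fun q hq => ?_) fun a ha b hb hab => ?_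
  · exact (Real.hasDerivAt_log hq.1.ne').neg
  · exact (hasDerivAt_inv hq.1.ne').neg.congr_deriv (neg_neg _)
  · exact neg_pos.mpr (Real.log_neg hq.1 hq.2)
  · exact mul_neg_of_pos_of_neg (by positivity) (neg_neg_of_pos (inv_pos.mpr hq.1))
  · have h1 := (Real.log_neg hq.1 hq.2).ne
    have h2 := hq.1.ne'
    field_simp
    ring
  · have := mul_pos (sub_pos.mpr hα1) (one_div_pos.mpr (neg_pos.mpr (Real.log_neg hq.1 hq.2)))
    linarith
  · have := mul_lt_mul_of_pos_left (one_div_neg_log_lt ha.1 hb.2 hab) (sub_pos.mpr hα1)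
    simp only
    linarith

/-- Demand `a + b * (q ^ (-t) - 1) ^ s`, common to the Singh–Maddala and the Pareto type IV
distributions. -/
theorem decreasingPassThrough_of_rpow_rpow {P : ℝ → ℝ} {a b s t : ℝ} (hb : 0 < b) (hs : 0 < s)
    (hs1 : s < 1) (ht : 0 < t) (hst : s * t ≤ 1)
    (hP : ∀ q, P q = a + b * (q ^ (-t) - 1) ^ s) : DecreasingPassThrough P (Ioo 0 1) := by
  have hpow : ∀ q ∈ Ioo (0 : ℝ) 1, 0 < q ^ t ∧ q ^ t < 1 := fun q hq =>
    ⟨Real.rpow_pos_of_pos hq.1 t, Real.rpow_lt_one hq.1.le hq.2 ht⟩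
  have hst' : 0 < (1 - s) * t := mul_pos (sub_pos.mpr hs1) ht
  refine decreasingPassThrough_of_rpow_comp (a := a) (b := b) (s := s)
    (z := fun q => q ^ (-t) - 1) (z₁ := fun q => -t * q ^ (-t - 1))
    (z₂ := fun q => -t * ((-t - 1) * q ^ (-t - 1 - 1)))
    (w := fun q => -t - 1 + (1 - s) * t * (1 / (1 - q ^ t))) hP
    (fun q hq => ?_) (fun q hq => ?_) (fun q hq => ?_) (fun q hq => ?_) (fun q hq => ?_)
    (fun q hq => ?_) fun a ha b hb hab => ?_
  · exact (Real.hasDerivAt_rpow_const (Or.inl hq.1.ne')).sub_const 1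
  · exact (Real.hasDerivAt_rpow_const (Or.inl hq.1.ne')).const_mul (-t)
  · exact sub_pos.mpr (Real.one_lt_rpow_of_pos_of_lt_one_of_neg hq.1 hq.2 (by linarith))
  · exact mul_neg_of_pos_of_neg (by positivity)
      (mul_neg_of_neg_of_pos (by linarith) (Real.rpow_pos_of_pos hq.1 _))
  · obtain ⟨h1, h2⟩ := hpow q hq
    have h3 := hq.1.ne'
    have h4 : 1 - q ^ t ≠ 0 := by linarith
    have h5 : q ^ (-t) - 1 = (1 - q ^ t) / q ^ t := by
      rw [Real.rpow_neg hq.1.le]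
      field_simp
    rw [h5, Real.rpow_sub_one h3 (-t - 1), Real.rpow_sub_one h3 (-t), Real.rpow_neg hq.1.le]
    field_simp
    ring
  · obtain ⟨h1, h2⟩ := hpow q hq
    have h3 : 1 < 1 / (1 - q ^ t) := by
      rw [lt_div_iff₀ (by linarith)]
      linarith
    have := mul_lt_mul_of_pos_left h3 hst'
    -- The curvature exceeds `-t - 1 + (1 - s) * t = -1 - s * t`; this is where `s * t ≤ 1` gives
    -- the bound `-2`.
    nlinarith
  · have h1 : a ^ t < b ^ t := Real.rpow_lt_rpow ha.1.le hab ht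
    have h2 : 1 / (1 - a ^ t) < 1 / (1 - b ^ t) :=
      one_div_lt_one_div_of_lt (by linarith [(hpow b hb).2]) (by linarith)
    have := mul_lt_mul_of_pos_left h2 hst'
    simp only
    linarith

theorem singhMaddala_passThrough {k a b : ℝ} (hk : 0 < k) (ha : 1 < a) (hb : 0 < b)
    (hak : 1 ≤ a * k) : DecreasingPassThrough (singhMaddala k a b) (Ioo 0 1) := by
  have ha0 : 0 < a := by linarith
  refine decreasingPassThrough_of_rpow_rpow (a := 0) (b := b) (s := 1 / a) (t := 1 / k) hb
    (by positivity) ((div_lt_one ha0).mpr ha) (by positivity) ?_ fun q => (zero_add _).symm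
  rw [div_mul_div_comm, one_mul, div_le_one (by positivity)]
  exact hak

theorem paretoIV_passThrough {k α γ μ : ℝ} (hk : 0 < k) (hα : 0 < α) (hγ : 0 < γ) (hγ1 : γ < 1)
    (hγα : γ ≤ α) : DecreasingPassThrough (paretoIV k α γ μ) (Ioo 0 1) := by
  refine decreasingPassThrough_of_rpow_rpow (a := μ) (b := k) (s := γ) (t := 1 / α) hk
    hγ hγ1 (by positivity) ?_ fun q => rfl
  rw [mul_one_div, div_le_one hα]
  exact hγα

theorem tukeyLambda_passThrough {lam : ℝ} (h1 : -1 ≤ lam) (h2 : lam < 1) :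
    DecreasingPassThrough (tukeyLambda lam) (Ioo 0 1) := by
  have hmono : ∀ a ∈ Ioo (0 : ℝ) 1, ∀ b ∈ Ioo (0 : ℝ) 1, a < b →
      b ^ (lam - 1) < a ^ (lam - 1) := fun a ha b _ hab =>
    Real.rpow_lt_rpow_of_neg ha.1 hab (by linarith)
  have hsymm : ∀ q ∈ Ioo (0 : ℝ) 1, 1 - q ∈ Ioo (0 : ℝ) 1 := fun q hq =>
    ⟨by linarith [hq.2], by linarith [hq.1]⟩
  have hpos : ∀ q ∈ Ioo (0 : ℝ) 1, 0 < q ^ (lam - 1) := fun q hq => Real.rpow_pos_of_pos hq.1 _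
  have hd : ∀ (s : ℝ), ∀ q ∈ Ioo (0 : ℝ) 1,
      HasDerivAt (fun q : ℝ => (1 - q) ^ s) (-(s * (1 - q) ^ (s - 1))) q := fun s q hq =>
    ((hasDerivAt_one_sub q).rpow_const (Or.inl (hsymm q hq).1.ne')).congr_deriv (by ring)
  refine decreasingPassThrough_unit_of_curvature
    (p := fun q => -((1 - q) ^ (lam - 1) + q ^ (lam - 1)))
    -- In this form both factors after `-1 +` are positive and increasing in `q`, and `-2 < w`
    -- follows from `1 - lam ≤ 2`. The case `lam = 0` needs no separate treatment after the first
    -- derivative.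
    (w := fun q => (1 - lam) * (-1 + 1 / (1 - q) *
      ((1 - q) ^ (lam - 1) / (q ^ (lam - 1) + (1 - q) ^ (lam - 1)))))
    (fun q hq => ?_) (fun q hq => ?_) (fun q hq => ?_) (fun q hq => ?_) fun a ha b hb hab => ?_
  · by_cases h0 : lam = 0
    · subst h0
      rw [show tukeyLambda 0 = fun q => Real.log ((1 - q) / q) from funext fun q => if_pos rfl]
      have h3 := hq.1.ne'
      have h4 := (hsymm q hq).1.ne'
      refine (((hasDerivAt_one_sub q).div (hasDerivAt_id q) h3).log
        (div_ne_zero h4 h3)).congr_deriv ?_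
      rw [zero_sub, Real.rpow_neg_one, Real.rpow_neg_one]
      simp only [Pi.div_apply, id]
      field_simp
      ring
    · rw [show tukeyLambda lam = fun q => ((1 - q) ^ lam - q ^ lam) / lam from
        funext fun q => if_neg h0]
      refine (((hd lam q hq).sub (Real.hasDerivAt_rpow_const (Or.inl hq.1.ne'))).div_const
        lam).congr_deriv ?_
      field_simp
      ring
  · linarith [hpos q hq, hpos _ (hsymm q hq)]
  · refine ((hd (lam - 1) q hq).add
      (Real.hasDerivAt_rpow_const (Or.inl hq.1.ne'))).neg.congr_deriv ?_
    have h3 := hq.1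
    have h4 := (hsymm q hq).1
    have h5 := hpos q hq
    have h6 := hpos _ (hsymm q hq)
    rw [Real.rpow_sub_one h3.ne' (lam - 1), Real.rpow_sub_one h4.ne' (lam - 1)]
    generalize q ^ (lam - 1) = A at *
    generalize (1 - q) ^ (lam - 1) = B at *
    have h7 : A + B ≠ 0 := by positivity
    field_simp
    ring
  · have h4 := (hsymm q hq).1
    have h5 := hpos q hq
    have h6 := hpos _ (hsymm q hq)
    have h7 : 0 < 1 / (1 - q) * ((1 - q) ^ (lam - 1) / (q ^ (lam - 1) + (1 - q) ^ (lam - 1))) := by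
      positivity
    nlinarith
  · have h3 := div_add_lt_div_add (hpos b hb) (hmono a ha b hb hab).le (hpos _ (hsymm a ha))
      (hmono _ (hsymm b hb) _ (hsymm a ha) (by linarith))
    have h4 : 1 / (1 - a) < 1 / (1 - b) := one_div_lt_one_div_of_lt (hsymm b hb).1 (by linarith)
    have h5 := mul_lt_mul'' h4 h3 (one_div_pos.mpr (hsymm a ha).1).le
      (div_pos (hpos _ (hsymm a ha)) (add_pos (hpos a ha) (hpos _ (hsymm a ha)))).le
    have := mul_lt_mul_of_pos_left h5 (sub_pos.mpr h2)
    simp only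
    linarith

theorem wakeby_passThrough {α β γ δ μ : ℝ} (hα : 0 < α) (hβ : 1 < β) (hγ : 0 < γ) (hδ : 0 < δ)
    (hδ1 : δ ≤ 1) : DecreasingPassThrough (wakeby α β γ δ μ) (Ioo 0 1) := by
  have hX : ∀ q ∈ Ioo (0 : ℝ) 1, 0 < γ * q ^ (-δ - 1) := fun q hq =>
    mul_pos hγ (Real.rpow_pos_of_pos hq.1 _)
  have hY : ∀ q ∈ Ioo (0 : ℝ) 1, 0 < α * q ^ (β - 1) := fun q hq =>
    mul_pos hα (Real.rpow_pos_of_pos hq.1 _)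
  refine decreasingPassThrough_unit_of_curvature
    (p := fun q => -(γ * q ^ (-δ - 1) + α * q ^ (β - 1)))
    -- The slope is a sum of two powers, so its elasticity is the average of the exponents `-δ - 1`
    -- and `β - 1` weighted by the terms. The weight of the larger exponent grows with `q`, and `δ ≤
    -- 1` keeps the average above `-2`.
    (w := fun q => -δ - 1 + (β + δ) *
      ((α * q ^ (β - 1)) / (γ * q ^ (-δ - 1) + α * q ^ (β - 1))))
    (fun q hq => ?_) (fun q hq => ?_) (fun q hq => ?_) (fun q hq => ?_) fun a ha b hb hab => ?_
  · have h1 : ∀ s : ℝ, HasDerivAt (fun q : ℝ => 1 - q ^ s) (-(s * q ^ (s - 1))) q := fun s =>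
      (Real.hasDerivAt_rpow_const (Or.inl hq.1.ne')).const_sub 1
    refine (((((h1 (-δ)).const_mul γ).div_const δ).const_sub μ).add
      (((h1 β).const_mul α).div_const β)).congr_deriv ?_
    have h2 : β ≠ 0 := by linarith
    field_simp
    ring
  · linarith [hX q hq, hY q hq]
  · refine (((Real.hasDerivAt_rpow_const (Or.inl hq.1.ne')).const_mul γ).add
      ((Real.hasDerivAt_rpow_const (Or.inl hq.1.ne')).const_mul α)).neg.congr_deriv ?_
    have h1 := hq.1.ne'
    have h2 := hX q hq
    have h3 := hY q hq
    rw [Real.rpow_sub_one h1 (-δ - 1), Real.rpow_sub_one h1 (β - 1)]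
    have h4 : γ * q ^ (-δ - 1) + α * q ^ (β - 1) ≠ 0 := (add_pos h2 h3).ne'
    field_simp
    ring
  · have h1 := div_pos (hY q hq) (add_pos (hX q hq) (hY q hq))
    have : 0 < (β + δ) * ((α * q ^ (β - 1)) / (γ * q ^ (-δ - 1) + α * q ^ (β - 1))) :=
      mul_pos (by linarith) h1
    linarith
  · have h1 : γ * b ^ (-δ - 1) ≤ γ * a ^ (-δ - 1) :=
      mul_le_mul_of_nonneg_left (Real.rpow_lt_rpow_of_neg ha.1 hab (by linarith)).le hγ.le
    have h2 : α * a ^ (β - 1) < α * b ^ (β - 1) :=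
      mul_lt_mul_of_pos_left (Real.rpow_lt_rpow ha.1.le hab (by linarith)) hα
    have := mul_lt_mul_of_pos_left (div_add_lt_div_add (hX b hb) h1 (hY a ha) h2)
      (show 0 < β + δ by linarith)
    simp only
    linarith

end Examples

/-! ### Fréchet demand -/

section Frechet

theorem nonneg_of_deriv_nonneg {f f' : ℝ → ℝ} (hf : ∀ x, HasDerivAt f (f' x) x)
    (hf' : ∀ x, 0 < x → 0 ≤ f' x) (h0 : f 0 = 0) {x : ℝ} (hx : 0 ≤ x) : 0 ≤ f x := by
  have hmono : MonotoneOn f (Ici 0) := by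
    refine monotoneOn_of_deriv_nonneg (convex_Ici 0)
      (fun x _ => (hf x).continuousAt.continuousWithinAt)
      (fun x _ => (hf x).differentiableAt.differentiableWithinAt) fun x hx => ?_
    rw [interior_Ici] at hx
    rw [(hf x).deriv]
    exact hf' x hx
  exact h0 ▸ hmono self_mem_Ici hx hx

theorem sub_one_mul_exp_add_one_nonneg {k : ℝ} (hk : 0 ≤ k) : 0 ≤ (k - 1) * Real.exp k + 1 := by
  refine nonneg_of_deriv_nonneg (f := fun k => (k - 1) * Real.exp k + 1)
    (f' := fun k => k * Real.exp k) (fun k => ?_) (fun k hk => by positivity) (by simp) hk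
  refine ((((hasDerivAt_id k).sub_const 1).mul (Real.hasDerivAt_exp k)).add_const 1).congr_deriv ?_
  simp only [id]
  ring

theorem sub_two_mul_exp_add_nonneg {k : ℝ} (hk : 0 ≤ k) :
    0 ≤ (k - 2) * Real.exp k + k + 2 := by
  refine nonneg_of_deriv_nonneg (f := fun k => (k - 2) * Real.exp k + k + 2)
    (f' := fun k => (k - 1) * Real.exp k + 1) (fun k => ?_)
    (fun k hk => sub_one_mul_exp_add_one_nonneg hk.le) (by simp) hk
  refine (((((hasDerivAt_id k).sub_const 2).mul (Real.hasDerivAt_exp k)).add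
    (hasDerivAt_id k)).add_const 2).congr_deriv ?_
  simp only [id]
  ring

theorem sq_sub_two_mul_add_two_mul_exp_nonneg {k : ℝ} (hk : 0 ≤ k) :
    0 ≤ (k ^ 2 - 2 * k + 2) * Real.exp k - 2 := by
  refine nonneg_of_deriv_nonneg (f := fun k => (k ^ 2 - 2 * k + 2) * Real.exp k - 2)
    (f' := fun k => k ^ 2 * Real.exp k) (fun k => ?_) (fun k hk => by positivity) (by simp) hk
  refine ((((((hasDerivAt_id k).pow 2).sub ((hasDerivAt_id k).const_mul 2)).add_const 2).mul
    (Real.hasDerivAt_exp k)).sub_const 2).congr_deriv ?_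
  simp
  ring

/-- The curvature of Fréchet demand as a function of `k = -log (1 - q)`, with `c = 1 + 1 / α`. -/
theorem strictMonoOn_frechet_curvature {c : ℝ} (hc : c < 2) :
    StrictMonoOn (fun k : ℝ => (Real.exp k - 1) * (1 - c / k)) (Ioi 0) := by
  have hd : ∀ k ∈ Ioi (0 : ℝ), HasDerivAt (fun k : ℝ => (Real.exp k - 1) * (1 - c / k))
      (Real.exp k * (1 - c / k) + (Real.exp k - 1) * (c / k ^ 2)) k := fun k hk => by
    have h1 : HasDerivAt (fun k : ℝ => 1 - c / k) (c / k ^ 2) k := by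
      refine (((hasDerivAt_const k c).div (hasDerivAt_id k) (ne_of_gt hk)).const_sub
        1).congr_deriv ?_
      simp only [id]
      ring
    exact ((Real.hasDerivAt_exp k).sub_const 1).mul h1
  refine strictMonoOn_of_deriv_pos (convex_Ioi 0)
    (fun k hk => (hd k hk).continuousAt.continuousWithinAt) fun k hk => ?_
  rw [interior_Ioi] at hk
  rw [(hd k hk).deriv]
  have hk0 : 0 < k := hk
  have h1 := sub_one_mul_exp_add_one_nonneg hk0.le
  have h2 := sq_sub_two_mul_add_two_mul_exp_nonneg hk0.le
  have h3 : Real.exp k * (1 - c / k) + (Real.exp k - 1) * (c / k ^ 2) =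
      (k ^ 2 * Real.exp k - c * ((k - 1) * Real.exp k + 1)) / k ^ 2 := by
    field_simp
    ring
  rw [h3]
  refine div_pos ?_ (by positivity)
  -- The numerator is affine and nonincreasing in `c`; at `c = 2` it equals `(k ^ 2 - 2 k + 2) exp k
  -- - 2`, which `h2` shows to be nonnegative. Since `c < 2`, it is positive when the coefficient of
  -- `-c` is, and reduces to `k ^ 2 * exp k` when that coefficient vanishes.
  rcases h1.eq_or_lt with h4 | h4
  · rw [← h4, mul_zero, sub_zero]
    positivity
  · nlinarith

theorem frechet_passThrough {α β μ : ℝ} (hα : 1 < α) (hβ : 0 < β) :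
    DecreasingPassThrough (frechet α β μ) (Ioo 0 1) := by
  have hα1 : 1 / α < 1 := (div_lt_one (by linarith)).mpr hα
  have hα0 : 0 < 1 / α := by positivity
  obtain ⟨t, ht⟩ : ∃ t, t = 1 / α := ⟨_, rfl⟩
  rw [← ht] at hα1 hα0
  have hk : ∀ q ∈ Ioo (0 : ℝ) 1, 0 < -Real.log (1 - q) := fun q hq =>
    neg_pos.mpr (Real.log_neg (by linarith [hq.2]) (by linarith [hq.1]))
  have hexp : ∀ q ∈ Ioo (0 : ℝ) 1, Real.exp (-Real.log (1 - q)) = 1 / (1 - q) := fun q hq => by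
    rw [Real.exp_neg, Real.exp_log (by linarith [hq.2]), one_div]
  refine decreasingPassThrough_of_rpow_comp (a := μ) (b := β) (s := -t)
    (z := fun q => -Real.log (1 - q)) (z₁ := fun q => 1 / (1 - q)) (z₂ := fun q => 1 / (1 - q) ^ 2)
    (w := fun q => (Real.exp (-Real.log (1 - q)) - 1) * (1 - (1 + t) / -Real.log (1 - q)))
    (fun q => by rw [frechet, ht]) (fun q hq => ?_) (fun q hq => ?_) hk
    (fun q hq => ?_) (fun q hq => ?_) (fun q hq => ?_) fun a ha b hb hab => ?_
  · have h1 : 0 < 1 - q := by linarith [hq.2]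
    exact ((hasDerivAt_one_sub q).log h1.ne').neg.congr_deriv (by ring)
  · have h1 : 0 < 1 - q := by linarith [hq.2]
    exact hasDerivAt_one_div_one_sub h1.ne'
  · exact mul_neg_of_neg_of_pos (by nlinarith) (one_div_pos.mpr (by linarith [hq.2]))
  · have h1 : 0 < 1 - q := by linarith [hq.2]
    have h2 := (hk q hq).ne'
    rw [hexp q hq]
    generalize -Real.log (1 - q) = k at *
    field_simp
    ring
  · have h1 := hk q hq
    generalize -Real.log (1 - q) = k at *
    -- In the extreme case `t = 1`, the bound `-2` is this inequality in weak form; the slack `h3`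
    -- from `t < 1` makes it strict.
    have h2 := sub_two_mul_exp_add_nonneg h1.le
    have h3 : 0 < (Real.exp k - 1) * (1 - t) :=
      mul_pos (by linarith [Real.add_one_lt_exp h1.ne']) (by linarith)
    have h4 : (Real.exp k - 1) * (1 - (1 + t) / k) =
        ((Real.exp k - 1) * (k - (1 + t))) / k := by
      field_simp
    rw [h4, lt_div_iff₀ h1]
    nlinarith
  · refine strictMonoOn_frechet_curvature (c := 1 + t) (by linarith) (hk a ha)
      (hk b hb) ?_
    exact neg_lt_neg (Real.log_lt_log (by linarith [hb.2]) (by linarith))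

end Frechet

/-! ### Cauchy demand: the curvature is `-2 y cot y` at `y = π q` -/

section Cauchy

theorem strictAntiOn_mul_cot :
    StrictAntiOn (fun y => y * Real.cos y / Real.sin y) (Ioo 0 Real.pi) := by
  have hs : ∀ y ∈ Ioo 0 Real.pi, 0 < Real.sin y := fun y hy =>
    Real.sin_pos_of_pos_of_lt_pi hy.1 hy.2
  have hd : ∀ y ∈ Ioo 0 Real.pi, HasDerivAt (fun y => y * Real.cos y / Real.sin y)
      ((Real.sin y * Real.cos y - y) / Real.sin y ^ 2) y := fun y hy => by
    refine (((hasDerivAt_id y).mul (Real.hasDerivAt_cos y)).div (Real.hasDerivAt_sin y)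
      (hs y hy).ne').congr_deriv ?_
    congr 1
    simp only [id, Pi.mul_apply]
    linear_combination (-y) * Real.sin_sq_add_cos_sq y
  refine strictAntiOn_of_deriv_neg (convex_Ioo _ _)
    (fun y hy => (hd y hy).continuousAt.continuousWithinAt) fun y hy => ?_
  rw [interior_Ioo] at hy
  rw [(hd y hy).deriv]
  refine div_neg_of_neg_of_pos ?_ (pow_pos (hs y hy) 2)
  have h1 := Real.sin_lt (x := 2 * y) (by linarith [hy.1])
  rw [Real.sin_two_mul] at h1
  linarith

theorem mul_cot_lt_one {y : ℝ} (h0 : 0 < y) (hpi : y < Real.pi) :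
    y * Real.cos y / Real.sin y < 1 := by
  have hs := Real.sin_pos_of_pos_of_lt_pi h0 hpi
  rw [div_lt_one hs]
  rcases lt_or_ge y (Real.pi / 2) with h | h
  · have hc := Real.cos_pos_of_mem_Ioo ⟨by linarith, h⟩
    have := Real.lt_tan h0 h
    rwa [Real.tan_eq_sin_div_cos, lt_div_iff₀ hc] at this
  · have hc := Real.cos_nonpos_of_pi_div_two_le_of_le h (by linarith)
    nlinarith

theorem cauchy_passThrough {a b : ℝ} (hb : 0 < b) :
    DecreasingPassThrough (cauchy a b) (Ioo 0 1) := by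
  have hpi := Real.pi_pos
  have hmem : ∀ q ∈ Ioo (0 : ℝ) 1, Real.pi * q ∈ Ioo 0 Real.pi := fun q hq =>
    ⟨mul_pos hpi hq.1, by nlinarith [hq.2]⟩
  have hs : ∀ q ∈ Ioo (0 : ℝ) 1, 0 < Real.sin (Real.pi * q) := fun q hq =>
    Real.sin_pos_of_pos_of_lt_pi (hmem q hq).1 (hmem q hq).2
  have hlin : ∀ q : ℝ, HasDerivAt (fun q => Real.pi * q) Real.pi q := fun q =>
    ((hasDerivAt_id q).const_mul Real.pi).congr_deriv (mul_one _)
  refine decreasingPassThrough_unit_of_curvature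
    (p := fun q => -(b * Real.pi) / Real.sin (Real.pi * q) ^ 2)
    (w := fun q => -2 * (Real.pi * q * Real.cos (Real.pi * q) / Real.sin (Real.pi * q)))
    (fun q hq => ?_) (fun q hq => ?_) (fun q hq => ?_) (fun q hq => ?_) fun x hx y hy hxy => ?_
  · have hc : Real.cos (Real.pi * (1 / 2 - q)) = Real.sin (Real.pi * q) := by
      rw [show Real.pi * (1 / 2 - q) = Real.pi / 2 - Real.pi * q by ring, Real.cos_pi_div_two_sub]
    have h1 : HasDerivAt (fun q => Real.pi * (1 / 2 - q)) (-Real.pi) q :=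
      (((hasDerivAt_id q).const_sub (1 / 2)).const_mul Real.pi).congr_deriv (by ring)
    have h2 := (hs q hq).ne'
    refine (((Real.hasDerivAt_tan (hc ▸ h2)).comp q h1).const_mul b |>.const_add a).congr_deriv ?_
    rw [hc]
    field_simp
  · exact div_neg_of_neg_of_pos (by nlinarith) (pow_pos (hs q hq) 2)
  · have h1 : HasDerivAt (fun q => Real.sin (Real.pi * q))
        (Real.cos (Real.pi * q) * Real.pi) q := (hlin q).sin
    have h2 := (hs q hq).ne'
    have h3 := hq.1.ne'
    refine ((hasDerivAt_const q (-(b * Real.pi))).div (h1.pow 2) (pow_ne_zero 2 h2)).congr_deriv ?_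
    simp only [Pi.pow_apply]
    field_simp
    norm_num
    ring
  · have := mul_cot_lt_one (hmem q hq).1 (hmem q hq).2
    linarith
  · have := strictAntiOn_mul_cot (hmem x hx) (hmem y hy) (mul_lt_mul_of_pos_left hxy hpi)
    simp only at this ⊢
    linarith

end Cauchy

/-! ### Laplace demand: two branches glued at `1 / 2` -/

section Laplace

/-- Marginal revenue of Laplace demand. -/
noncomputable def laplaceMarginalRevenue (μ β q : ℝ) : ℝ :=
  if q ≤ 1 / 2 then μ - β * Real.log (2 * q) - β
  else μ + β * Real.log (2 * (1 - q)) - β * (q / (1 - q))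

variable {μ β q : ℝ}

theorem hasDerivAt_log_two_mul (hq : q ≠ 0) :
    HasDerivAt (fun q : ℝ => Real.log (2 * q)) (1 / q) q := by
  refine (((hasDerivAt_id q).const_mul 2).log (mul_ne_zero two_ne_zero hq)).congr_deriv ?_
  simp only [id]
  field_simp

theorem hasDerivAt_log_two_mul_one_sub (hq : 1 - q ≠ 0) :
    HasDerivAt (fun q : ℝ => Real.log (2 * (1 - q))) (-(1 / (1 - q))) q := by
  refine (((hasDerivAt_one_sub q).const_mul 2).log (mul_ne_zero two_ne_zero hq)).congr_deriv ?_
  field_simp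

theorem hasDerivAt_laplace_left (hq : q ≠ 0) :
    HasDerivAt (fun q => μ - β * Real.log (2 * q)) (-β / q) q :=
  (((hasDerivAt_log_two_mul hq).const_mul β).const_sub μ).congr_deriv (by ring)

theorem hasDerivAt_laplace_right (hq : 1 - q ≠ 0) :
    HasDerivAt (fun q => μ + β * Real.log (2 * (1 - q))) (-β / (1 - q)) q :=
  (((hasDerivAt_log_two_mul_one_sub hq).const_mul β).const_add μ).congr_deriv (by ring)

theorem hasDerivAt_laplaceMarginalRevenue_left (hq : q ≠ 0) :
    HasDerivAt (fun q => μ - β * Real.log (2 * q) - β) (-β / q) q :=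
  (hasDerivAt_laplace_left hq).sub_const β

theorem hasDerivAt_laplaceMarginalRevenue_right (hq : 1 - q ≠ 0) :
    HasDerivAt (fun q => μ + β * Real.log (2 * (1 - q)) - β * (q / (1 - q)))
      (-β / (1 - q) - β * (1 / (1 - q) ^ 2)) q := by
  refine (hasDerivAt_laplace_right hq).sub (HasDerivAt.const_mul β ?_)
  refine ((hasDerivAt_id q).div (hasDerivAt_one_sub q) hq).congr_deriv ?_
  simp only [id]
  field_simp
  ring

theorem laplace_eqOn_right :
    EqOn (laplace μ β) (fun q => μ + β * Real.log (2 * (1 - q))) (Ici (1 / 2)) := by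
  intro q hq
  rcases (show 1 / 2 ≤ q from hq).eq_or_lt with rfl | h
  · rw [laplace, if_pos le_rfl]
    norm_num
  · exact if_neg (not_le.mpr h)

theorem laplaceMarginalRevenue_eqOn_right : EqOn (laplaceMarginalRevenue μ β)
    (fun q => μ + β * Real.log (2 * (1 - q)) - β * (q / (1 - q))) (Ici (1 / 2)) := by
  intro q hq
  rcases (show 1 / 2 ≤ q from hq).eq_or_lt with rfl | h
  · rw [laplaceMarginalRevenue, if_pos le_rfl]
    norm_num
  · exact if_neg (not_le.mpr h)

/-- The two branches of demand have the same value and slope at `1 / 2`, so revenue is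
differentiable there too. Marginal revenue is continuous, but its slope jumps from `-2 * β` to `-6 *
β`, which is why the rate is considered only off `1 / 2`. -/
theorem hasDerivAt_laplace_revenue (hq : q ∈ Ioo (0 : ℝ) 1) :
    HasDerivAt (fun x => laplace μ β x * x) (laplaceMarginalRevenue μ β q) q := by
  have h0 := hq.1.ne'
  have h1 : 1 - q ≠ 0 := by linarith [hq.2]
  have hl : q ≤ 1 / 2 → HasDerivWithinAt (fun x => laplace μ β x * x)
      (laplaceMarginalRevenue μ β q) (Iic (1 / 2)) q := fun h => by
    refine (((hasDerivAt_laplace_left (μ := μ) (β := β) h0).mul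
      (hasDerivAt_id q)).hasDerivWithinAt.congr_deriv ?_).congr (fun x hx => ?_) ?_
    · rw [laplaceMarginalRevenue, if_pos h]
      simp only [id]
      field_simp
      ring
    · rw [laplace, if_pos (show x ≤ 1 / 2 from hx)]; rfl
    · rw [laplace, if_pos h]; rfl
  have hr : 1 / 2 ≤ q → HasDerivWithinAt (fun x => laplace μ β x * x)
      (laplaceMarginalRevenue μ β q) (Ici (1 / 2)) q := fun h => by
    refine (((hasDerivAt_laplace_right (μ := μ) (β := β) h1).mul
      (hasDerivAt_id q)).hasDerivWithinAt.congr_deriv ?_).congr (fun x hx => ?_) ?_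
    · rw [laplaceMarginalRevenue_eqOn_right h]
      simp only [id]
      field_simp
      ring
    · rw [laplace_eqOn_right hx]; rfl
    · rw [laplace_eqOn_right h]; rfl
  rcases lt_trichotomy q (1 / 2) with h | h | h
  · exact (hl h.le).hasDerivAt (Iic_mem_nhds h)
  · have := (hl h.le).union (hr h.ge)
    rw [Iic_union_Ici] at this
    exact this.hasDerivAt univ_mem
  · exact (hr h.le).hasDerivAt (Ici_mem_nhds h)

theorem continuousOn_laplaceMarginalRevenue :
    ContinuousOn (laplaceMarginalRevenue μ β) (Ioo 0 1) := by
  intro q hq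
  have h0 := hq.1.ne'
  have h1 : 1 - q ≠ 0 := by linarith [hq.2]
  refine ContinuousAt.continuousWithinAt ?_
  have hl : q ≤ 1 / 2 → ContinuousWithinAt (laplaceMarginalRevenue μ β) (Iic (1 / 2)) q :=
    fun h => (hasDerivAt_laplaceMarginalRevenue_left h0).continuousAt.continuousWithinAt.congr
      (fun x hx => if_pos hx) (if_pos h)
  have hr : 1 / 2 ≤ q → ContinuousWithinAt (laplaceMarginalRevenue μ β) (Ici (1 / 2)) q :=
    fun h => (hasDerivAt_laplaceMarginalRevenue_right h1).continuousAt.continuousWithinAt.congr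
      (fun x hx => laplaceMarginalRevenue_eqOn_right hx) (laplaceMarginalRevenue_eqOn_right h)
  rcases lt_trichotomy q (1 / 2) with h | h | h
  · exact (hl h.le).continuousAt (Iic_mem_nhds h)
  · have := (hl h.le).union (hr h.ge)
    rw [Iic_union_Ici] at this
    exact this.continuousAt univ_mem
  · exact (hr h.le).continuousAt (Ici_mem_nhds h)

theorem laplaceMarginalRevenue_right_deriv_neg (hβ : 0 < β) (hq : q < 1) :
    -β / (1 - q) - β * (1 / (1 - q) ^ 2) < 0 := by
  have h1 : 0 < 1 - q := by linarith
  have h2 : 0 < β * (1 / (1 - q) ^ 2) := by positivity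
  have h3 : -β / (1 - q) < 0 := div_neg_of_neg_of_pos (by linarith) h1
  linarith

theorem strictAntiOn_laplaceMarginalRevenue (hβ : 0 < β) :
    StrictAntiOn (laplaceMarginalRevenue μ β) (Ioo 0 1) := by
  have hl : StrictAntiOn (laplaceMarginalRevenue μ β) (Ioc 0 (1 / 2)) := by
    refine StrictAntiOn.congr (f₁ := fun q => μ - β * Real.log (2 * q) - β) ?_
      fun q hq => (if_pos hq.2).symm
    refine strictAntiOn_of_deriv_neg (convex_Ioc _ _) (fun q hq =>
      (hasDerivAt_laplaceMarginalRevenue_left hq.1.ne').continuousAt.continuousWithinAt)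
      fun q hq => ?_
    rw [interior_Ioc] at hq
    rw [(hasDerivAt_laplaceMarginalRevenue_left hq.1.ne').deriv]
    exact div_neg_of_neg_of_pos (by linarith) hq.1
  have hr : StrictAntiOn (laplaceMarginalRevenue μ β) (Ico (1 / 2) 1) := by
    refine StrictAntiOn.congr
      (f₁ := fun q => μ + β * Real.log (2 * (1 - q)) - β * (q / (1 - q))) ?_
      fun q hq => (laplaceMarginalRevenue_eqOn_right hq.1).symm
    refine strictAntiOn_of_deriv_neg (convex_Ico _ _) (fun q hq =>
      (hasDerivAt_laplaceMarginalRevenue_right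
        (by linarith [hq.2])).continuousAt.continuousWithinAt)
      fun q hq => ?_
    rw [interior_Ico] at hq
    rw [(hasDerivAt_laplaceMarginalRevenue_right (by linarith [hq.2])).deriv]
    exact laplaceMarginalRevenue_right_deriv_neg hβ hq.2
  have := hl.union hr (isGreatest_Ioc (by norm_num)) (isLeast_Ico (by norm_num))
  rwa [Ioc_union_Ico_eq_Ioo (by norm_num) (by norm_num)] at this

theorem laplace_passThrough (hβ : 0 < β) : ∃ ρ : ℝ → ℝ,
    IsPassThroughRateOn (laplace μ β) (Ioo 0 1) (Ioo 0 1 \ {1 / 2}) ρ ∧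
    AntitoneOn ρ (Ioo 0 1 \ {1 / 2}) ∧ (∀ q ∈ Ioo (0 : ℝ) (1 / 2), ρ q = 1) ∧
    StrictAntiOn ρ (Ioo (1 / 2) 1) := by
  have hR : ∀ {q : ℝ}, 1 / 2 < q → (if q < 1 / 2 then (1 : ℝ) else 1 / (1 + 1 / (1 - q))) =
      1 / (1 + 1 / (1 - q)) := fun h => if_neg (not_lt.mpr h.le)
  have hstrict : StrictAntiOn (fun q : ℝ => if q < 1 / 2 then (1 : ℝ) else 1 / (1 + 1 / (1 - q)))
      (Ioo (1 / 2) 1) := fun a ha b hb hab => by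
    simp only
    rw [hR ha.1, hR hb.1]
    have h1 : 0 < 1 - b := by linarith [hb.2]
    have h2 : 1 / (1 - a) < 1 / (1 - b) := one_div_lt_one_div_of_lt h1 (by linarith)
    have h3 : 0 < 1 / (1 - a) := one_div_pos.mpr (by linarith)
    exact one_div_lt_one_div_of_lt (by linarith) (by linarith)
  refine ⟨fun q => if q < 1 / 2 then 1 else 1 / (1 + 1 / (1 - q)), ?_, ?_, fun q hq =>
    if_pos hq.2, hstrict⟩
  · rintro q ⟨hq, hq2⟩ r
    have key : ∀ {p m : ℝ}, HasDerivAt (laplace μ β) p q →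
        HasDerivAt (laplaceMarginalRevenue μ β) m q → m ≠ 0 →
        (HasPassThroughRate (laplace μ β) (Ioo 0 1) q r ↔ r = p / m) := fun hp hm hm0 =>
      hasPassThroughRate_iff isOpen_Ioo ordConnected_Ioo
        (fun _ => hasDerivAt_laplace_revenue) (strictAntiOn_laplaceMarginalRevenue hβ)
        continuousOn_laplaceMarginalRevenue hq hp hm hm0
    have h0 := hq.1.ne'
    have h1 : 1 - q ≠ 0 := by linarith [hq.2]
    rcases lt_or_gt_of_ne hq2 with h | h
    · have hn : -β / q ≠ 0 := div_ne_zero (by linarith) h0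
      rw [key ((hasDerivAt_laplace_left (μ := μ) h0).congr_of_eventuallyEq ?_)
        ((hasDerivAt_laplaceMarginalRevenue_left (μ := μ) h0).congr_of_eventuallyEq ?_) hn, div_self hn]
      · simp only
        rw [if_pos h]
      · filter_upwards [Iic_mem_nhds h] with y hy using if_pos hy
      · filter_upwards [Iic_mem_nhds h] with y hy using if_pos hy
    · rw [key ((hasDerivAt_laplace_right (μ := μ) (β := β) h1).congr_of_eventuallyEq ?_)
        ((hasDerivAt_laplaceMarginalRevenue_right (μ := μ) (β := β) h1).congr_of_eventuallyEq ?_)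
        (laplaceMarginalRevenue_right_deriv_neg hβ hq.2).ne]
      · simp only
        rw [hR h]
        have h3 : 0 < 1 - q := by linarith [hq.2]
        have h4 : -β / (1 - q) - β * (1 / (1 - q) ^ 2) = -β / (1 - q) * (1 + 1 / (1 - q)) := by
          field_simp
          ring
        have h5 : -β / (1 - q) ≠ 0 := div_ne_zero (by linarith) h1
        rw [h4, div_mul_eq_div_div, div_self h5]
      · filter_upwards [Ici_mem_nhds h] with y hy using laplace_eqOn_right hy
      · filter_upwards [Ici_mem_nhds h] with y hy using laplaceMarginalRevenue_eqOn_right hy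
  · rintro a ⟨ha, ha2⟩ b ⟨hb, hb2⟩ hab
    rcases lt_or_gt_of_ne ha2 with h | h
    · simp only
      rw [if_pos h]
      split_ifs with h3
      · exact le_rfl
      · have h4 : 0 < 1 / (1 - b) := one_div_pos.mpr (by linarith [hb.2])
        rw [div_le_one (by linarith)]
        linarith
    · exact hstrict.antitoneOn ⟨h, ha.2⟩ ⟨lt_of_lt_of_le h hab, hb.2⟩ hab

end Laplace

/-! ### Gamma demand via bounds on the Mills ratio -/

section Gamma

theorem pos_of_deriv_neg_of_tendsto {f f' : ℝ → ℝ} {p : ℝ}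
    (hf : ∀ t ∈ Ici p, HasDerivAt f (f' t) t) (hf' : ∀ t ∈ Ici p, f' t < 0)
    (hlim : Tendsto f atTop (𝓝 0)) : 0 < f p := by
  have hanti : StrictAntiOn f (Ici p) := by
    refine strictAntiOn_of_deriv_neg (convex_Ici p)
      (fun t ht => (hf t ht).continuousAt.continuousWithinAt) fun t ht => ?_
    rw [(hf t (interior_subset ht)).deriv]
    exact hf' t (interior_subset ht)
  have h1 : f (p + 1) < f p := hanti self_mem_Ici (by simp) (by linarith)
  refine (le_of_tendsto hlim ?_).trans_lt h1
  filter_upwards [eventually_ge_atTop (p + 1)] with t ht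
  exact hanti.antitoneOn (show p ≤ p + 1 by linarith) (show p ≤ t by linarith) ht

variable {S φ : ℝ → ℝ} {k r : ℝ}

section MillsRatio

variable (hk : 0 < k) (hφ : ∀ p ∈ Ioi (0 : ℝ), 0 < φ p)
  (hφd : ∀ p ∈ Ioi (0 : ℝ), HasDerivAt φ (φ p * (k / p - r)) p)
  (hφlim : Tendsto φ atTop (𝓝 0))
  (hS : ∀ p ∈ Ioi (0 : ℝ), HasDerivAt S (-φ p) p) (hSlim : Tendsto S atTop (𝓝 0))

theorem hasDerivAt_const_div {p : ℝ} (hp : p ≠ 0) :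
    HasDerivAt (fun p => r - k / p) (k / p ^ 2) p := by
  refine (((hasDerivAt_const p k).div (hasDerivAt_id p) hp).const_sub r).congr_deriv ?_
  simp only [id]
  ring

include hφ hφlim in
theorem tendsto_density_mul {b : ℝ → ℝ} {p C : ℝ} (hp : 0 < p)
    (hb : ∀ t ∈ Ici p, 0 ≤ b t ∧ b t ≤ C) : Tendsto (fun t => φ t * b t) atTop (𝓝 0) := by
  have h1 : Tendsto (fun t => φ t * C) atTop (𝓝 0) := by simpa using hφlim.mul_const C
  refine tendsto_of_tendsto_of_tendsto_of_le_of_le' tendsto_const_nhds h1 ?_ ?_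
  · filter_upwards [eventually_ge_atTop p] with t ht
    exact mul_nonneg (hφ t (hp.trans_le ht)).le (hb t ht).1
  · filter_upwards [eventually_ge_atTop p] with t ht
    exact mul_le_mul_of_nonneg_left (hb t ht).2 (hφ t (hp.trans_le ht)).le

include hk in
theorem hazard_gap_mono {p t : ℝ} (hp : 0 < p) (ht : p ≤ t) : r - k / p ≤ r - k / t := by
  have : k / t ≤ k / p := div_le_div_of_nonneg_left hk.le hp ht
  linarith

include hφ hS hSlim in
theorem survival_pos {p : ℝ} (hp : 0 < p) : 0 < S p :=
  pos_of_deriv_neg_of_tendsto (fun t ht => hS t (hp.trans_le ht))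
    (fun t ht => neg_neg_of_pos (hφ t (hp.trans_le ht))) hSlim

include hk hφ hφd hφlim hS hSlim

/-- Write `l = r - k / p`, so that `φ' = -l φ` and `l' = k / p ^ 2 > 0`. The difference `φ / l - S`
tends to `0` at infinity and has derivative `-φ l' / l ^ 2 < 0`, hence is positive. -/
theorem survival_lt {p : ℝ} (hp : 0 < p) (hl : 0 < r - k / p) : S p < φ p / (r - k / p) := by
  have hlt : ∀ t ∈ Ici p, 0 < r - k / t := fun t ht => hl.trans_le (hazard_gap_mono hk hp ht)
  have hpos : ∀ t ∈ Ici p, 0 < t := fun t ht => hp.trans_le ht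
  refine sub_pos.mp (pos_of_deriv_neg_of_tendsto (f := fun t => φ t / (r - k / t) - S t)
    (f' := fun t => -(φ t * (k / t ^ 2) / (r - k / t) ^ 2)) (fun t ht => ?_) (fun t ht => ?_) ?_)
  · refine (((hφd t (hpos t ht)).div (hasDerivAt_const_div (hpos t ht).ne')
      (hlt t ht).ne').sub (hS t (hpos t ht))).congr_deriv ?_
    have h1 := (hlt t ht).ne'
    rw [show k / t - r = -(r - k / t) by ring]
    generalize k / t ^ 2 = m
    generalize r - k / t = l at *
    field_simp
    ring
  · have h1 := hφ t (hpos t ht)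
    have h2 := hlt t ht
    have h3 := hpos t ht
    exact neg_neg_of_pos (by positivity)
  · have h1 := tendsto_density_mul hφ hφlim (b := fun t => (r - k / t)⁻¹) (C := (r - k / p)⁻¹) hp
      fun t ht => ⟨(inv_pos.mpr (hlt t ht)).le, inv_anti₀ hl (hazard_gap_mono hk hp ht)⟩
    simpa [div_eq_mul_inv] using h1.sub hSlim

/-- The comparison function `φ l / (l ^ 2 + l')`, with `l = r - k / p`, is the value of `S` at which
the derivative of the curvature `-S l / φ` would vanish. The difference again decreases to `0` at
infinity. -/
theorem lt_survival {p : ℝ} (hp : 0 < p) (hl : 0 < r - k / p) :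
    φ p * ((r - k / p) / ((r - k / p) ^ 2 + k / p ^ 2)) < S p := by
  have hlt : ∀ t ∈ Ici p, 0 < r - k / t := fun t ht => hl.trans_le (hazard_gap_mono hk hp ht)
  have hpos : ∀ t ∈ Ici p, 0 < t := fun t ht => hp.trans_le ht
  have hden : ∀ t ∈ Ici p, 0 < (r - k / t) ^ 2 + k / t ^ 2 := fun t ht => by
    have h1 := hlt t ht
    have h2 := hpos t ht
    positivity
  refine sub_pos.mp (pos_of_deriv_neg_of_tendsto
    (f := fun t => S t - φ t * ((r - k / t) / ((r - k / t) ^ 2 + k / t ^ 2)))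
    (f' := fun t => -(φ t * (2 * (k / t ^ 2) ^ 2 + (r - k / t) * (2 * k / t ^ 3)) /
      ((r - k / t) ^ 2 + k / t ^ 2) ^ 2)) (fun t ht => ?_) (fun t ht => ?_) ?_)
  · have h0 := (hpos t ht).ne'
    have h1 := hasDerivAt_const_div (r := r) (k := k) h0
    have h2 : HasDerivAt (fun t => k / t ^ 2) (-(2 * k / t ^ 3)) t := by
      refine ((hasDerivAt_const t k).div (hasDerivAt_pow 2 t) (pow_ne_zero 2 h0)).congr_deriv ?_
      field_simp
      norm_num
      ring
    refine ((hS t (hpos t ht)).sub ((hφd t (hpos t ht)).mul (h1.div ((h1.pow 2).add h2)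
      (hden t ht).ne'))).congr_deriv ?_
    have h3 := (hden t ht).ne'
    simp only [Pi.add_apply, Pi.pow_apply, Pi.div_apply]
    rw [show k / t - r = -(r - k / t) by ring]
    generalize 2 * k / t ^ 3 = n at *
    generalize k / t ^ 2 = m at *
    generalize r - k / t = l at *
    field_simp
    norm_num
    ring
  · have h1 := hφ t (hpos t ht)
    have h2 := hlt t ht
    have h3 := hpos t ht
    have h4 := hden t ht
    exact neg_neg_of_pos (by positivity)
  · have h1 := tendsto_density_mul hφ hφlim
      (b := fun t => (r - k / t) / ((r - k / t) ^ 2 + k / t ^ 2)) (C := (r - k / p)⁻¹) hp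
      fun t ht => ⟨(div_pos (hlt t ht) (hden t ht)).le, by
        refine le_trans ?_ (inv_anti₀ hl (hazard_gap_mono hk hp ht))
        have h1 := hlt t ht
        have h2 : 0 < k / t ^ 2 := div_pos hk (pow_pos (hpos t ht) 2)
        rw [div_le_iff₀ (hden t ht), mul_add, sq, inv_mul_cancel_left₀ h1.ne']
        have : 0 ≤ (r - k / t)⁻¹ * (k / t ^ 2) := by positivity
        linarith⟩
    simpa using hSlim.sub h1

theorem neg_two_lt_mills_mul {p : ℝ} (hp : 0 < p) : -2 < S p * (k / p - r) / φ p := by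
  have h1 := hφ p hp
  have h2 := survival_pos hφ hS hSlim hp
  rw [lt_div_iff₀ h1]
  rcases le_or_gt 0 (k / p - r) with h | h
  · have := mul_nonneg h2.le h
    linarith
  · have hl : 0 < r - k / p := by linarith
    have h3 := survival_lt hk hφ hφd hφlim hS hSlim hp hl
    rw [lt_div_iff₀ hl] at h3
    linarith

/-- This is the curvature as a function of price. Its derivative is negative at once where the
density is nondecreasing (`r ≤ k / p`), and by the lower Mills bound elsewhere. -/
theorem strictAntiOn_mills_mul : StrictAntiOn (fun p => S p * (k / p - r) / φ p) (Ioi 0) := by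
  have hd : ∀ p ∈ Ioi (0 : ℝ), HasDerivAt (fun p => S p * (k / p - r) / φ p)
      ((r - k / p) - S p / φ p * ((r - k / p) ^ 2 + k / p ^ 2)) p := fun p hp => by
    have h1 : HasDerivAt (fun p => k / p - r) (-(k / p ^ 2)) p := by
      refine (hasDerivAt_const_div (r := r) (k := k) (ne_of_gt hp)).neg.congr_of_eventuallyEq
        (.of_forall fun x => ?_)
      simp
    refine (((hS p hp).mul h1).div (hφd p hp) (hφ p hp).ne').congr_deriv ?_
    have h2 := (hφ p hp).ne'
    simp only [Pi.mul_apply]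
    rw [show r - k / p = -(k / p - r) by ring]
    generalize k / p ^ 2 = m at *
    generalize k / p - r = l at *
    field_simp
    ring
  refine strictAntiOn_of_deriv_neg (convex_Ioi 0)
    (fun p hp => (hd p hp).continuousAt.continuousWithinAt) fun p hp => ?_
  rw [interior_Ioi] at hp
  rw [(hd p hp).deriv]
  have hp0 : 0 < p := hp
  have h1 := hφ p hp
  have h2 := survival_pos hφ hS hSlim hp0
  have h3 : 0 < (r - k / p) ^ 2 + k / p ^ 2 := by positivity
  rcases le_or_gt (r - k / p) 0 with h | h
  · have : 0 < S p / φ p * ((r - k / p) ^ 2 + k / p ^ 2) := by positivity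
    linarith
  · have h4 := lt_survival hk hφ hφd hφlim hS hSlim hp0 h
    rw [← mul_div_assoc, div_lt_iff₀ h3] at h4
    rw [div_mul_eq_mul_div, sub_neg, lt_div_iff₀ h1]
    linarith

/-- Decreasing pass-through for demand generated by a survival function `S` on the positive reals
whose density has the logarithmic derivative `k / p - r` of a gamma density. -/
theorem decreasingPassThrough_of_survival {P : ℝ → ℝ}
    (hP : ∀ q ∈ Ioo (0 : ℝ) 1, 0 < P q ∧ S (P q) = q) : DecreasingPassThrough P (Ioo 0 1) := by
  have hSa : StrictAntiOn S (Ioi 0) := by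
    refine strictAntiOn_of_deriv_neg (convex_Ioi 0)
      (fun p hp => (hS p hp).continuousAt.continuousWithinAt) fun p hp => ?_
    rw [interior_Ioi] at hp
    rw [(hS p hp).deriv]
    exact neg_neg_of_pos (hφ p hp)
  have hPd : ∀ q ∈ Ioo (0 : ℝ) 1, HasDerivAt P (-φ (P q))⁻¹ q := fun q hq =>
    hasDerivAt_of_strictAntiOn_inverse isOpen_Ioi hSa rfl
      (mem_of_superset (isOpen_Ioo.mem_nhds hq) hP) (hS _ (hP q hq).1)
      (neg_ne_zero.mpr (hφ _ (hP q hq).1).ne')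
  -- From `P' = -1 / φ(P)`, the elasticity of `P'` is `q φ'(P) / φ(P) ^ 2`, with `q = S (P q)`.
  -- Price falls in quantity, so curvature decreasing in price is increasing in `q`.
  refine decreasingPassThrough_unit_of_curvature (p := fun q => (-φ (P q))⁻¹)
    (w := fun q => S (P q) * (k / P q - r) / φ (P q)) hPd
    (fun q hq => inv_neg''.mpr (neg_neg_of_pos (hφ _ (hP q hq).1))) (fun q hq => ?_)
    (fun q hq => neg_two_lt_mills_mul hk hφ hφd hφlim hS hSlim (hP q hq).1)
    fun a ha b hb hab => ?_
  · have h1 := (hφ _ (hP q hq).1).ne'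
    have h2 := hq.1.ne'
    refine (((hφd _ (hP q hq).1).comp q (hPd q hq)).neg.inv (neg_ne_zero.mpr h1)).congr_deriv ?_
    rw [(hP q hq).2]
    simp only [Function.comp_apply, Pi.neg_apply]
    generalize k / P q - r = l
    field_simp
  · refine strictAntiOn_mills_mul hk hφ hφd hφlim hS hSlim (hP b hb).1 (hP a ha).1 ?_
    by_contra! hle
    have := hSa.antitoneOn (hP a ha).1 (hP b hb).1 hle
    rw [(hP a ha).2, (hP b hb).2] at this
    linarith

end MillsRatio

open ProbabilityTheory

variable {a : ℝ}

theorem integrable_gammaPDFReal (ha : 0 < a) (hr : 0 < r) : Integrable (gammaPDFReal a r) := by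
  refine ⟨(stronglyMeasurable_gammaPDFReal a r).aestronglyMeasurable, ?_⟩
  rw [hasFiniteIntegral_iff_ofReal (.of_forall fun x => gammaPDFReal_nonneg ha hr x)]
  have := lintegral_gammaPDF_eq_one ha hr
  simp only [gammaPDF] at this
  rw [this]
  exact ENNReal.one_lt_top

theorem gammaPDFReal_eventuallyEq {p : ℝ} (hp : 0 < p) : gammaPDFReal a r =ᶠ[𝓝 p]
    fun x => r ^ a / Real.Gamma a * x ^ (a - 1) * Real.exp (-(r * x)) := by
  filter_upwards [Ioi_mem_nhds hp] with x hx using if_pos (le_of_lt hx)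

theorem hasDerivAt_gammaPDFReal {p : ℝ} (hp : 0 < p) :
    HasDerivAt (gammaPDFReal a r) (gammaPDFReal a r p * ((a - 1) / p - r)) p := by
  have h1 : HasDerivAt (fun x => Real.exp (-(r * x))) (Real.exp (-(r * p)) * -(r * 1)) p :=
    ((hasDerivAt_id p).const_mul r).neg.exp
  refine (((((Real.hasDerivAt_rpow_const (Or.inl hp.ne')).const_mul _).mul h1).congr_deriv
    ?_).congr_of_eventuallyEq (gammaPDFReal_eventuallyEq hp))
  rw [(gammaPDFReal_eventuallyEq hp).self_of_nhds, Real.rpow_sub_one hp.ne' (a - 1)]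
  field_simp
  ring

theorem tendsto_gammaPDFReal (hr : 0 < r) : Tendsto (gammaPDFReal a r) atTop (𝓝 0) := by
  have h1 := (tendsto_rpow_mul_exp_neg_mul_atTop_nhds_zero (a - 1) r hr).const_mul
    (r ^ a / Real.Gamma a)
  rw [mul_zero] at h1
  refine h1.congr' ?_
  filter_upwards [eventually_ge_atTop 0] with x hx
  rw [gammaPDFReal, if_pos hx, neg_mul, mul_assoc]

theorem hasDerivAt_cdf_gammaMeasure (ha : 0 < a) (hr : 0 < r) {p : ℝ} (hp : 0 < p) :
    HasDerivAt (cdf (gammaMeasure a r)) (gammaPDFReal a r p) p := by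
  have hint := integrable_gammaPDFReal ha hr
  have h1 : HasDerivAt (fun x => ∫ t in (0 : ℝ)..x, gammaPDFReal a r t) (gammaPDFReal a r p) p :=
    intervalIntegral.integral_hasDerivAt_right hint.intervalIntegrable
      (stronglyMeasurable_gammaPDFReal a r).stronglyMeasurableAtFilter
      (hasDerivAt_gammaPDFReal hp).continuousAt
  refine (h1.const_add (cdf (gammaMeasure a r) 0)).congr_of_eventuallyEq
    (.of_forall fun x => ?_)
  rw [cdf_gammaMeasure_eq_integral ha hr, cdf_gammaMeasure_eq_integral ha hr]
  beta_reduce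
  rw [← intervalIntegral.integral_Iic_sub_Iic hint.integrableOn hint.integrableOn]
  ring

theorem gamma_passThrough {α β : ℝ} {P : ℝ → ℝ} (hα : 1 < α) (hβ : 0 < β)
    (hP : IsGammaInverseDemand α β P) : DecreasingPassThrough P (Ioo 0 1) := by
  have hα0 : 0 < α := by linarith
  have hr : 0 < 1 / β := by positivity
  refine decreasingPassThrough_of_survival (k := α - 1) (r := 1 / β)
    (φ := gammaPDFReal α (1 / β)) (S := fun p => 1 - cdf (gammaMeasure α (1 / β)) p)
    (by linarith) (fun p hp => gammaPDFReal_pos hα0 hr hp) (fun p hp => hasDerivAt_gammaPDFReal hp)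
    (tendsto_gammaPDFReal hr)
    (fun p hp => (hasDerivAt_cdf_gammaMeasure hα0 hr hp).const_sub 1) ?_ hP
  simpa using (tendsto_cdf_atTop (gammaMeasure α (1 / β))).const_sub 1

end Gamma

end PassThrough

theorem theorem8 :
    -- the theorem: the complete monotonicity criterion makes pass-through decreasing in quantity,
    -- except for Bulow–Pfleiderer demand, where it is constant
    (∀ (P : ℝ → ℝ) (qbar : EReal), IsInverseDemand P qbar →
      CompleteMonotonicityCriterion P qbar →
        (¬ IsBulowPfleiderer P (quantityRange qbar) →
          DecreasingPassThrough P (quantityRange qbar)) ∧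
        (IsBulowPfleiderer P (quantityRange qbar) →
          ConstantPassThrough P (quantityRange qbar))) ∧
    -- the corollary: the listed demand functions
    (∀ (β ε : ℝ) (qbar : EReal), 0 < β → 1 < ε →
      ConstantPassThrough (constantElasticity β ε) (quantityRange qbar)) ∧
    (∀ (μ β ε : ℝ) (qbar : EReal), 0 < β → 1 < ε →
      ConstantPassThrough (constantPassThroughDemand μ β ε) (quantityRange qbar)) ∧
    (∀ μ β : ℝ, 0 < β → DecreasingPassThrough (logistic μ β) (Ioo 0 1)) ∧
    (∀ γ σ : ℝ, 1 < γ → 0 < σ → DecreasingPassThrough (logLogistic γ σ) (Ioo 0 1)) ∧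
    (∀ α β : ℝ, 0 < β → DecreasingPassThrough (gumbel α β) (Ioo 0 1)) ∧
    (∀ α β : ℝ, 1 < α → 0 < β → DecreasingPassThrough (weibull α β) (Ioo 0 1)) ∧
    (∀ α β μ : ℝ, 1 < α → 0 < β → DecreasingPassThrough (frechet α β μ) (Ioo 0 1)) ∧
    (∀ (α β : ℝ) (P : ℝ → ℝ), 1 < α → 0 < β → IsGammaInverseDemand α β P →
      DecreasingPassThrough P (Ioo 0 1)) ∧
    (∀ μ β : ℝ, 0 < β → ∃ ρ : ℝ → ℝ,
      IsPassThroughRateOn (laplace μ β) (Ioo 0 1) (Ioo 0 1 \ {1 / 2}) ρ ∧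
      AntitoneOn ρ (Ioo 0 1 \ {1 / 2}) ∧
      (∀ q ∈ Ioo (0 : ℝ) (1 / 2), ρ q = 1) ∧
      StrictAntiOn ρ (Ioo (1 / 2) 1)) ∧
    (∀ k a b : ℝ, 0 < k → 1 < a → 0 < b → 1 ≤ a * k →
      DecreasingPassThrough (singhMaddala k a b) (Ioo 0 1)) ∧
    (∀ lam : ℝ, -1 ≤ lam → lam < 1 → DecreasingPassThrough (tukeyLambda lam) (Ioo 0 1)) ∧
    (∀ α β γ δ μ : ℝ, 0 < α → 1 < β → 0 < γ → 0 < δ → δ ≤ 1 →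
      DecreasingPassThrough (wakeby α β γ δ μ) (Ioo 0 1)) ∧
    (∀ k α γ μ : ℝ, 0 < k → 0 < α → 0 < γ → γ < 1 → γ ≤ α →
      DecreasingPassThrough (paretoIV k α γ μ) (Ioo 0 1)) ∧
    (∀ μ σ γ : ℝ, 0 < σ → γ < 1 →
      ConstantPassThrough (generalizedPareto μ σ γ) (Ioo 0 1)) ∧
    (∀ a b : ℝ, 0 < b → DecreasingPassThrough (cauchy a b) (Ioo 0 1)) := by
  exact ⟨fun _ _ hP hcrit => passThrough_of_criterion hP hcrit,
    fun _ _ qbar hβ hε => constantElasticity_passThrough qbar hβ hε,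
    fun _ _ _ qbar hβ hε => constantPassThroughDemand_passThrough qbar hβ hε,
    fun _ _ hβ => logistic_passThrough hβ,
    fun _ _ hγ hσ => logLogistic_passThrough hγ hσ,
    fun _ _ hβ => gumbel_passThrough hβ,
    fun _ _ hα hβ => weibull_passThrough hα hβ,
    fun _ _ _ hα hβ => frechet_passThrough hα hβ,
    fun _ _ _ hα hβ hP => gamma_passThrough hα hβ hP,
    fun _ _ hβ => laplace_passThrough hβ,
    fun _ _ _ hk ha hb hak => singhMaddala_passThrough hk ha hb hak,
    fun _ h1 h2 => tukeyLambda_passThrough h1 h2,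
    fun _ _ _ _ _ hα hβ hγ hδ hδ1 => wakeby_passThrough hα hβ hγ hδ hδ1,
    fun _ _ _ _ hk hα hγ hγ1 hγα => paretoIV_passThrough hk hα hγ hγ1 hγα,
    fun _ _ _ hσ hγ => generalizedPareto_passThrough hσ hγ,
    fun _ _ hb => cauchy_passThrough hb⟩
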